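/- For a finite simple undirected graph $G=(V,E)$ with edge costs $c:E\to\mathbb{Q}_{\ge 0}$ and an edge set $J\subseteq E$, let $\delta_J(v)$ be the set of edges of $J$ incident to $v$. The power of a node $v$ in $J$ is $p_J(v)=\max_{e\in\delta_J(v)}c(e)$ if $\delta_J(v)\neq\emptyset$, and $p_J(v)=0$ otherwise; the power of $J$ is $p_J(V)=\sum_{v\in V}p_J(v)$. Given degree bounds $r(v)\in\mathbb{Z}_{\ge 0}$ for $v\in V$, an $r$-edge cover is a set $J\subseteq E$ with $|\delta_J(v)|\ge r(v)$ for every $v\in V$. Minimum-Power Edge-Multi-Cover is the problem of finding, for given $G$, $c$, $r$, an $r$-edge cover $J\subseteq E$ of minimum power. Let $k=\max_{v\in V}r(v)$. Theorem. Minimum-Power Edge-Multi-Cover admits a polynomial-time $(k+\frac12)$-approximation algorithm: there is one algorithm that, on every instance $(G,c,r)$, halts after a number of steps that is at most a fixed polynomial in the number of bits of the instance, and that, whenever the instance has an $r$-edge cover, outputs an $r$-edge cover $J\subseteq E$ with $$p_J(V)\le\left(k+\tfrac12\right)\cdot\min\{p_{J'}(V): J'\subseteq E \text{ is an } r\text{-edge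 cover}\}.$$ -/

import Mathlib

/-!
A random access machine with natural-number words and a structured instruction set.
It has finitely many registers and finitely many arrays in any given program.  Every evaluated
operation of an expression and every executed instruction is charged one unit of time.
The only arithmetic is addition, truncated subtraction and halving, so that one operation increases
the bit length of the largest word by at most one; hence polynomially many steps on this machine are
the same as polynomial time on a Turing machine (there is no multiplication at unit cost).
-/

namespace RAM

/-- The memory: registers `reg x` and arrays `arr a`, with cells `arr a i`. -/
structure State where
  reg : ℕ → ℕ
  arr : ℕ → ℕ → ℕ

/-- Expressions.  Register names, array names and literals are constants of the program;
array cells are addressed by computed values. -/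
inductive Expr where
  | lit (c : ℕ)
  | reg (x : ℕ)
  | get (a : ℕ) (i : Expr)
  | add (e f : Expr)
  | sub (e f : Expr)
  | half (e : Expr)

/-- The value of an expression. -/
def Expr.eval (s : State) : Expr → ℕ
  | .lit c => c
  | .reg x => s.reg x
  | .get a i => s.arr a (i.eval s)
  | .add e f => e.eval s + f.eval s
  | .sub e f => e.eval s - f.eval s
  | .half e => e.eval s / 2

/-- The time charged for evaluating an expression: one unit for each of its operations. -/
def Expr.time : Expr → ℕ
  | .lit _ => 1
  | .reg _ => 1
  | .get _ i => i.time + 1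
  | .add e f => e.time + f.time + 1
  | .sub e f => e.time + f.time + 1
  | .half e => e.time + 1

/-- Programs.  A test `e` counts as true if its value is not zero. -/
inductive Program where
  | noop
  | assign (x : ℕ) (e : Expr)
  | store (a : ℕ) (i e : Expr)
  | seq (P Q : Program)
  | ite (e : Expr) (P Q : Program)
  | loop (e : Expr) (P : Program)

/-- `s` with register `x` set to `w`. -/
def State.setReg (s : State) (x w : ℕ) : State :=
  { s with reg := Function.update s.reg x w }

/-- `s` with cell `i` of array `a` set to `w`. -/
def State.setArr (s : State) (a i w : ℕ) : State :=
  { s with arr := Function.update s.arr a (Function.update (s.arr a) i w) }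

/-- `Exec P s s' t`: started in memory `s`, the program `P` halts after exactly `t` units of time,
with memory `s'`. -/
inductive Exec : Program → State → State → ℕ → Prop where
  | noop (s : State) : Exec .noop s s 1
  | assign (x : ℕ) (e : Expr) (s : State) :
      Exec (.assign x e) s (s.setReg x (e.eval s)) (e.time + 1)
  | store (a : ℕ) (i e : Expr) (s : State) :
      Exec (.store a i e) s (s.setArr a (i.eval s) (e.eval s)) (i.time + e.time + 1)
  | seq {P Q : Program} {s s' s'' : State} {t t' : ℕ} :
      Exec P s s' t → Exec Q s' s'' t' → Exec (.seq P Q) s s'' (t + t' + 1)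
  | ite_true {e : Expr} {P Q : Program} {s s' : State} {t : ℕ} :
      e.eval s ≠ 0 → Exec P s s' t → Exec (.ite e P Q) s s' (e.time + t + 1)
  | ite_false {e : Expr} {P Q : Program} {s s' : State} {t : ℕ} :
      e.eval s = 0 → Exec Q s s' t → Exec (.ite e P Q) s s' (e.time + t + 1)
  | loop_true {e : Expr} {P : Program} {s s' s'' : State} {t t' : ℕ} :
      e.eval s ≠ 0 → Exec P s s' t → Exec (.loop e P) s' s'' t' →
        Exec (.loop e P) s s'' (e.time + t + t' + 1)
  | loop_false {e : Expr} {P : Program} {s : State} :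
      e.eval s = 0 → Exec (.loop e P) s s (e.time + 1)

end RAM

noncomputable section

/-- An instance of Minimum-Power Edge-Multi-Cover: a simple graph on `Fin n`, nonnegative rational
edge costs (the values of `cost` off the edges are never used) and degree bounds. -/
structure MPEMC where
  n : ℕ
  graph : SimpleGraph (Fin n)
  cost : Sym2 (Fin n) → ℚ≥0
  req : Fin n → ℕ

namespace MPEMC

/-- The set `δ_J(v)` of edges of `J` that are incident to `v`. -/
def incident {n : ℕ} (J : Finset (Sym2 (Fin n))) (v : Fin n) : Finset (Sym2 (Fin n)) :=
  J.filter (fun e => v ∈ e)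

/-- The power of a node: the largest cost of an edge of `J` incident to `v`, and `0` if there is
none (the supremum of the empty set in `ℚ≥0`). -/
def nodePower (I : MPEMC) (J : Finset (Sym2 (Fin I.n))) (v : Fin I.n) : ℚ≥0 :=
  (incident J v).sup I.cost

/-- The power of the subgraph with edge set `J`. -/
def power (I : MPEMC) (J : Finset (Sym2 (Fin I.n))) : ℚ≥0 :=
  ∑ v, I.nodePower J v

/-- `J` is a feasible solution: a set of edges of the graph that has degree at least `r(v)` at every
node `v`. -/
def IsCover (I : MPEMC) (J : Finset (Sym2 (Fin I.n))) : Prop :=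
  (∀ e ∈ J, e ∈ I.graph.edgeSet) ∧ ∀ v, I.req v ≤ (incident J v).card

/-- The maximum degree bound `k`. -/
def maxReq (I : MPEMC) : ℕ := Finset.univ.sup I.req

open Classical in
/-- Entry `(i, j)` of the matrix of cost numerators (`0` for non-adjacent pairs). -/
def num (I : MPEMC) (i j : Fin I.n) : ℕ :=
  if I.graph.Adj i j then (I.cost s(i, j)).num else 0

open Classical in
/-- Entry `(i, j)` of the matrix of cost denominators; `0` marks the non-adjacent pairs. -/
def den (I : MPEMC) (i j : Fin I.n) : ℕ :=
  if I.graph.Adj i j then (I.cost s(i, j)).den else 0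

/-- An `n × n` matrix as an array: entry `(i, j)` is in cell `i * n + j`. -/
def rowMajor {n : ℕ} (M : Fin n → Fin n → ℕ) (m : ℕ) : ℕ :=
  if h : m < n * n then
    M (finProdFinEquiv.symm ⟨m, h⟩).1 (finProdFinEquiv.symm ⟨m, h⟩).2
  else 0

/-- The memory that holds the input: `n` in register `0`, the degree bounds in array `0`, the
numerators and denominators of the costs in arrays `1` and `2`, and `0` everywhere else. -/
def input (I : MPEMC) : RAM.State where
  reg x := if x = 0 then I.n else 0
  arr a m :=
    if a = 0 then (if h : m < I.n then I.req ⟨m, h⟩ else 0)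
    else if a = 1 then rowMajor I.num m
    else if a = 2 then rowMajor I.den m
    else 0

/-- The number of bits of the input: the sum over all input words of their binary lengths, plus
one for each word. -/
def size (I : MPEMC) : ℕ :=
  (I.n.size + 1) + ∑ v, ((I.req v).size + 1) +
    ∑ i, ∑ j, (((I.num i j).size + 1) + ((I.den i j).size + 1))

/-- The edge set that is read off the memory at the end: the pairs `ij` such that cell
`i * n + j` of array `3` is not zero. -/
def output (I : MPEMC) (s : RAM.State) : Finset (Sym2 (Fin I.n)) :=
  (Finset.univ.filter (fun q : Fin I.n × Fin I.n => s.arr 3 (q.1 * I.n + q.2) ≠ 0)).image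
    (fun q => s(q.1, q.2))

end MPEMC

end

/-!
In every feasible solution some edge at `v` is not cheaper than the `r(v)`-th cheapest edge at `v`;
let `w(v)` be the cost of the latter, so that `w(V)` is at most the power of every solution. If each
`v` takes its `r(v)` cheapest edges and pays `w(v)` for each of them at their other ends, then the
power is at most `(k + 1) w(V)`. A vertex saves one of these payments if it is *covered* by an edge
at least as expensive as its `r(v)`-th one, so that `r(v) - 1` cheapest edges suffice.

The algorithm covers vertices by stars. It selects a star if the newly covered weight exceeds twice
the amount by which the star raises powers above the weights. For a given center and a most
expensive leaf the difference of the two is a sum over the other leaves, so that the best star is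
easy to find; and since the newly covered weight only shrinks, no pair needs a second look. The
selected stars thus cost at most `w(c) / 2` above `w(V)`, where `c` is the set of covered vertices.

When no such star is left, the powers `P` of any solution bound the uncovered weight: a minimal
set of edges of the solution that covers the uncovered vertices is a union of stars, none of them
gains more than its price, and the prices add up to at most `2 (P(V) - w(V))`. Altogether the power
found is at most `(k + 1/2) w(V) + (P(V) - w(V))`, which is at most `(k + 1/2) P(V)` for `1 ≤ k`.

Multiplying the costs by the product of their denominators makes them natural numbers. The machine
does this by binary multiplication, whose number of rounds is the bit length of a denominator.
-/

namespace RAM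

infixr:60 ";;" => Program.seq

@[simp] theorem State.setReg_reg (s : State) (x w y : ℕ) :
    (s.setReg x w).reg y = if y = x then w else s.reg y := by
  simp only [State.setReg, Function.update_apply]

@[simp] theorem State.setReg_arr (s : State) (x w : ℕ) : (s.setReg x w).arr = s.arr := rfl

@[simp] theorem State.setArr_reg (s : State) (a i w : ℕ) : (s.setArr a i w).reg = s.reg := rfl

@[simp] theorem State.setArr_arr (s : State) (a i w b : ℕ) :
    (s.setArr a i w).arr b = if b = a then Function.update (s.arr a) i w else s.arr b := by
  simp only [State.setArr, Function.update_apply]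

namespace Expr

instance : Add Expr := ⟨add⟩

instance : Sub Expr := ⟨sub⟩

instance : Zero Expr := ⟨lit 0⟩

instance : One Expr := ⟨lit 1⟩

/-- Logical negation of a test. -/
def not (e : Expr) : Expr := 1 - e

/-- Logical disjunction of two tests. -/
def or (e f : Expr) : Expr := e + f

/-- Logical conjunction of two tests. -/
def and (e f : Expr) : Expr := not (or (not e) (not f))

/-- The test `e < f`. -/
def lt (e f : Expr) : Expr := f - e

/-- The test `e ≤ f`. -/
def le (e f : Expr) : Expr := not (lt f e)

/-- The test `e = f`. -/
def eq (e f : Expr) : Expr := and (le e f) (le f e)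

/-- The larger one of two values. -/
def max (e f : Expr) : Expr := e + (f - e)

/-- The truth value of a test: nonzero words count as true. -/
def IsTrue (e : Expr) (s : State) : Prop := e.eval s ≠ 0

variable (s : State) (e f : Expr) (a x : ℕ)

@[simp] theorem eval_zero : (0 : Expr).eval s = 0 := rfl

@[simp] theorem eval_one : (1 : Expr).eval s = 1 := rfl

@[simp] theorem eval_reg : (reg x).eval s = s.reg x := rfl

@[simp] theorem eval_get : (get a e).eval s = s.arr a (e.eval s) := rfl

@[simp] theorem eval_add : (e + f).eval s = e.eval s + f.eval s := rfl

@[simp] theorem eval_sub : (e - f).eval s = e.eval s - f.eval s := rfl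

@[simp] theorem eval_half : (half e).eval s = e.eval s / 2 := rfl

@[simp] theorem eval_max : (max e f).eval s = Max.max (e.eval s) (f.eval s) := by
  simp only [max, eval_add, eval_sub]; omega

@[simp] theorem isTrue_get : (get a e).IsTrue s ↔ s.arr a (e.eval s) ≠ 0 := Iff.rfl

@[simp] theorem isTrue_not : (not e).IsTrue s ↔ ¬ e.IsTrue s := by
  simp only [IsTrue, not, eval_sub, eval_one]; omega

@[simp] theorem isTrue_or : (or e f).IsTrue s ↔ e.IsTrue s ∨ f.IsTrue s := by
  simp only [IsTrue, or, eval_add]; omega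

@[simp] theorem isTrue_and : (and e f).IsTrue s ↔ e.IsTrue s ∧ f.IsTrue s := by
  simp only [and, isTrue_not, isTrue_or, not_or, not_not]

@[simp] theorem isTrue_lt : (lt e f).IsTrue s ↔ e.eval s < f.eval s := by
  simp only [IsTrue, lt, eval_sub]; omega

@[simp] theorem isTrue_le : (le e f).IsTrue s ↔ e.eval s ≤ f.eval s := by
  simp only [le, isTrue_not, isTrue_lt, not_lt]

@[simp] theorem isTrue_eq : (eq e f).IsTrue s ↔ e.eval s = f.eval s := by
  simp only [eq, isTrue_and, isTrue_le, le_antisymm_iff]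

end Expr

namespace Program

/-- Whether some instruction of the program assigns to register `x`. -/
def writesReg (x : ℕ) : Program → Bool
  | .noop => false
  | .assign y _ => x == y
  | .store _ _ _ => false
  | .seq P Q => P.writesReg x || Q.writesReg x
  | .ite _ P Q => P.writesReg x || Q.writesReg x
  | .loop _ P => P.writesReg x

/-- Whether some instruction of the program stores into array `a`. -/
def writesArr (a : ℕ) : Program → Bool
  | .noop => false
  | .assign _ _ => false
  | .store b _ _ => a == b
  | .seq P Q => P.writesArr a || Q.writesArr a
  | .ite _ P Q => P.writesArr a || Q.writesArr a
  | .loop _ P => P.writesArr a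

/-- A bound for the running time, as a polynomial in a bound for the number of iterations of each
execution of a loop. -/
noncomputable def timeBound : Program → Polynomial ℕ
  | .noop => 1
  | .assign _ e => (e.time + 1 : ℕ)
  | .store _ i e => (i.time + e.time + 1 : ℕ)
  | .seq P Q => P.timeBound + Q.timeBound + 1
  | .ite e P Q => (e.time : Polynomial ℕ) + (P.timeBound + Q.timeBound) + 1
  | .loop e P => (Polynomial.X + 1) * ((e.time : Polynomial ℕ) + P.timeBound + 1)

/-- The conditional without an alternative branch. -/
def when (e : Expr) (P : Program) : Program := .ite e P .noop

/-- The loop `for x < reg y do P`, where register `b` holds `x * reg y`: if `reg y` is the length of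
the rows of a matrix, this is the offset of row `x`. -/
def forLoop (y x b : ℕ) (P : Program) : Program :=
  .assign x 0 ;; .assign b 0 ;; .loop (.lt (.reg x) (.reg y))
    (P ;; .assign x (.reg x + 1) ;; .assign b (.reg b + .reg y))

/-- `P` can be the body of `forLoop y x b P`: it leaves the three registers of the loop alone. -/
abbrev IsForBody (y x b : ℕ) (P : Program) : Prop :=
  [y, x, b].Nodup ∧ ∀ z ∈ [y, x, b], P.writesReg z = false

end Program

/-- Two memories agree outside of the registers and arrays that the program `P` writes. -/
structure Frame (P : Program) (s s' : State) : Prop where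
  reg : ∀ x, P.writesReg x = false → s'.reg x = s.reg x
  arr : ∀ a, P.writesArr a = false → s'.arr a = s.arr a

namespace Frame

variable {P : Program} {s s' s'' : State}

theorem refl (P : Program) (s : State) : Frame P s s := ⟨fun _ _ => rfl, fun _ _ => rfl⟩

theorem trans (h : Frame P s s') (h' : Frame P s' s'') : Frame P s s'' :=
  ⟨fun x hx => (h'.reg x hx).trans (h.reg x hx), fun a ha => (h'.arr a ha).trans (h.arr a ha)⟩

theorem mono {Q : Program} (h : Frame P s s')
    (hr : ∀ x, Q.writesReg x = false → P.writesReg x = false)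
    (ha : ∀ a, Q.writesArr a = false → P.writesArr a = false) : Frame Q s s' :=
  ⟨fun x hx => h.reg x (hr x hx), fun a h' => h.arr a (ha a h')⟩

end Frame

theorem Exec.frame {P : Program} {s s' : State} {t : ℕ} (h : Exec P s s' t) : Frame P s s' := by
  induction h with
  | noop s => exact .refl _ s
  | assign x e s => exact ⟨fun y hy => by simp_all [Program.writesReg], fun _ _ => rfl⟩
  | store a i e s => exact ⟨fun _ _ => rfl, fun b hb => by simp_all [Program.writesArr]⟩
  | seq _ _ ih₁ ih₂ =>
    exact (ih₁.mono (by simp_all [Program.writesReg]) (by simp_all [Program.writesArr])).trans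
      (ih₂.mono (by simp_all [Program.writesReg]) (by simp_all [Program.writesArr]))
  | ite_true _ _ ih | ite_false _ _ ih =>
    exact ih.mono (by simp_all [Program.writesReg]) (by simp_all [Program.writesArr])
  | loop_true _ _ _ ih₁ ih₂ => exact .trans ⟨ih₁.reg, ih₁.arr⟩ ih₂
  | loop_false _ => exact .refl _ _

/-- The registers `x` and `b` hold the index and the offset of row `v` of an `n × n` matrix. -/
structure AtRow {n : ℕ} (s : State) (x b : ℕ) (v : Fin n) : Prop where
  index : s.reg x = v
  offset : s.reg b = v * n

/-- Total correctness with a time bound: `P` started in `s` halts within the time `P.timeBound`,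
evaluated at `M`, in a memory that satisfies `Q`. -/
def Runs (M : ℕ) (P : Program) (s : State) (Q : State → Prop) : Prop :=
  ∃ s' t, Exec P s s' t ∧ t ≤ P.timeBound.eval M ∧ Q s'

namespace Runs

variable {M : ℕ} {P P' : Program} {s : State} {Q Q' : State → Prop} {e : Expr} {p : Prop}

theorem mono (h : Runs M P s Q) (hQ : ∀ s', Frame P s s' → Q s' → Q' s') : Runs M P s Q' := by
  obtain ⟨s', t, hexec, ht, hs'⟩ := h
  exact ⟨s', t, hexec, ht, hQ s' hexec.frame hs'⟩

theorem noop (h : Q s) : Runs M .noop s Q :=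
  ⟨s, 1, .noop s, by simp [Program.timeBound], h⟩

theorem assign {x : ℕ} (h : Q (s.setReg x (e.eval s))) : Runs M (.assign x e) s Q :=
  ⟨_, _, .assign x e s, by simp [Program.timeBound], h⟩

theorem store {a : ℕ} {i : Expr} (h : Q (s.setArr a (i.eval s) (e.eval s))) :
    Runs M (.store a i e) s Q :=
  ⟨_, _, .store a i e s, by simp [Program.timeBound], h⟩

theorem seq (h : Runs M P s (fun s' => Runs M P' s' Q)) : Runs M (P ;; P') s Q := by
  obtain ⟨s', t, hexec, ht, s'', t', hexec', ht', hs''⟩ := h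
  refine ⟨s'', _, .seq hexec hexec', ?_, hs''⟩
  simp only [Program.timeBound, Polynomial.eval_add, Polynomial.eval_one]
  omega

theorem ite (he : e.IsTrue s ↔ p) (h : p → Runs M P s Q) (h' : ¬ p → Runs M P' s Q) :
    Runs M (.ite e P P') s Q := by
  have timeBound_ite : (Program.ite e P P').timeBound.eval M =
      e.time + (P.timeBound.eval M + P'.timeBound.eval M) + 1 := by simp [Program.timeBound]
  by_cases hp : p
  · obtain ⟨s', t, hexec, ht, hs'⟩ := h hp
    exact ⟨s', _, .ite_true (he.2 hp) hexec, by omega, hs'⟩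
  · obtain ⟨s', t, hexec, ht, hs'⟩ := h' hp
    exact ⟨s', _, .ite_false (not_not.1 (mt he.1 hp)) hexec, by omega, hs'⟩

theorem when (he : e.IsTrue s ↔ p) (h : p → Runs M P s Q) (h' : ¬ p → Q s) :
    Runs M (.when e P) s Q :=
  .ite he h fun hp => .noop (h' hp)

theorem loop {k : ℕ} (hk : k ≤ M) (Inv : ℕ → State → Prop) (init : Inv 0 s)
    (step : ∀ i < k, ∀ s', Frame (.loop e P) s s' → Inv i s' →
      e.IsTrue s' ∧ Runs M P s' (Inv (i + 1)))
    (halt : ∀ s', Frame (.loop e P) s s' → Inv k s' → ¬ e.IsTrue s') :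
    Runs M (.loop e P) s (Inv k) := by
  have remaining : ∀ j i s', i + j = k → Frame (.loop e P) s s' → Inv i s' →
      ∃ s'' t, Exec (.loop e P) s' s'' t ∧
        t ≤ (j + 1) * (e.time + P.timeBound.eval M + 1) ∧ Inv k s'' := by
    intro j
    induction j with
    | zero =>
      rintro i s' rfl hf hs'
      exact ⟨s', _, .loop_false (not_not.1 (halt s' hf hs')), by omega, hs'⟩
    | succ j ih =>
      intro i s' hi hf hs'
      obtain ⟨he, s₁, t₁, hexec, ht₁, hs₁⟩ := step i (by omega) s' hf hs'
      have hf₁ : Frame (.loop e P) s' s₁ := ⟨hexec.frame.reg, hexec.frame.arr⟩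
      obtain ⟨s₂, t₂, hexec', ht₂, hs₂⟩ := ih (i + 1) s₁ (by omega) (hf.trans hf₁) hs₁
      refine ⟨s₂, _, .loop_true he hexec hexec', ?_, hs₂⟩
      rw [add_mul _ 1, one_mul]
      omega
  obtain ⟨s', t, hexec, ht, hs'⟩ := remaining k 0 s (zero_add k) (.refl _ s) init
  refine ⟨s', t, hexec, ht.trans ?_, hs'⟩
  simp only [Program.timeBound, Polynomial.eval_mul, Polynomial.eval_add, Polynomial.eval_X,
    Polynomial.eval_one, Polynomial.eval_natCast, Nat.cast_id]
  gcongr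

theorem forLoop_nat {y x b : ℕ} (hP : P.IsForBody y x b) (Inv : ℕ → State → Prop)
    (hInv : ∀ i s w w', Inv i s → Inv i ((s.setReg x w).setReg b w'))
    (hM : s.reg y ≤ M) (init : Inv 0 s)
    (step : ∀ i < s.reg y, ∀ s', Frame (P.forLoop y x b) s s' → s'.reg x = i →
      s'.reg b = i * s.reg y → Inv i s' → Runs M P s' (Inv (i + 1))) :
    Runs M (P.forLoop y x b) s fun s' => Inv (s.reg y) s' ∧ s'.reg b = s.reg y * s.reg y := by
  simp only [Program.IsForBody, List.nodup_cons, List.mem_cons, List.not_mem_nil, or_false,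
    not_or, forall_eq_or_imp, forall_eq, List.nodup_nil, not_false_eq_true, and_true] at hP
  obtain ⟨⟨⟨hyx, hyb⟩, hxb⟩, hPy, hPx, hPb⟩ := hP
  have frame_of_loop {s'} (hf : Frame (.loop (.lt (.reg x) (.reg y))
      (P ;; .assign x (.reg x + 1) ;; .assign b (.reg b + .reg y)))
        ((s.setReg x 0).setReg b 0) s') : Frame (P.forLoop y x b) s s' := by
    refine ⟨fun z hz => ?_, fun a ha => ?_⟩
    · simp only [Program.forLoop, Program.writesReg, Bool.or_eq_false_iff,
        beq_eq_false_iff_ne] at hz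
      rw [hf.reg z (by simp [Program.writesReg, hz])]
      simp [hz]
    · simp only [Program.forLoop, Program.writesArr, Bool.or_eq_false_iff] at ha
      exact hf.arr a (by simp [Program.writesArr, ha])
  have reg_y {s'} (hf : Frame (P.forLoop y x b) s s') : s'.reg y = s.reg y :=
    hf.reg y (by simp [Program.forLoop, Program.writesReg, hPy, hyx, hyb])
  refine .seq (.assign (.seq (.assign (.mono (.loop hM
    (fun i s' => Inv i s' ∧ s'.reg x = i ∧ s'.reg b = i * s.reg y) ?_ ?_ ?_)
    fun s' _ h => ⟨h.1, h.2.2⟩))))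
  · exact ⟨hInv 0 s _ _ init, by simp [hxb], by simp⟩
  · rintro i hi s' hf ⟨hI, hx, hb⟩
    have hy := reg_y (frame_of_loop hf)
    refine ⟨by simpa [hx, hy] using hi,
      .seq (.mono (step i hi s' (frame_of_loop hf) hx hb hI) fun s'' hf' hI' => ?_)⟩
    refine .seq (.assign (.assign ⟨hInv _ _ _ _ hI', ?_, ?_⟩))
    · simp [hxb, hf'.reg x hPx, hx]
    · simp [Ne.symm hxb, hyx, hf'.reg b hPb, hf'.reg y hPy, hb, hy, add_mul]
  · rintro s' hf ⟨-, hx, -⟩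
    simp [hx, reg_y (frame_of_loop hf)]

theorem forLoop {n y x b : ℕ} (hn : s.reg y = n) (hP : P.IsForBody y x b) (hM : n ≤ M)
    (Inv : Finset (Fin n) → State → Prop)
    (hInv : ∀ A s w w', Inv A s → Inv A ((s.setReg x w).setReg b w')) (init : Inv ∅ s)
    (step : ∀ v A s', v ∉ A → Frame (P.forLoop y x b) s s' → AtRow s' x b v → Inv A s' →
      Runs M P s' (Inv (insert v A))) :
    Runs M (P.forLoop y x b) s fun s' => Inv Finset.univ s' ∧ s'.reg b = n * n := by
  subst hn
  refine .mono (.forLoop_nat hP (fun i => Inv {t | (t : ℕ) < i}) (fun i => hInv _) hM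
    (by simpa using init) fun i hi s' hf hx hb h => ?_) fun s' _ h => ⟨by simpa using h.1, h.2⟩
  refine (step ⟨i, hi⟩ _ s' (by simp) hf ⟨hx, hb⟩ h).mono fun s'' _ h' => ?_
  convert h' using 1
  ext t
  simp [Fin.ext_iff, le_iff_eq_or_lt]

end Runs

end RAM

/-- A star cover of the vertex set `R` in the graph `H`, for a relation `Q` that says which edges
are useful at which of their ends: every `v ∈ R` is a leaf whose edge to its center is useful
at `v`, or it is the center of a leaf whose edge is useful at `v`. Stars may share vertices, but the
edge of a leaf is never useful at a center that is itself a leaf. -/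
structure StarCover {V : Type*} (H : SimpleGraph V) (Q : V → V → Prop) (R : Set V) where
  leaves : Finset V
  center : V → V
  mem_of_leaf : ∀ v ∈ leaves, v ∈ R
  adj_center : ∀ v ∈ leaves, H.Adj v (center v)
  useful_center : ∀ v ∈ leaves, Q v (center v)
  not_useful_of_center_mem : ∀ v ∈ leaves, center v ∈ leaves → ¬ Q (center v) v
  exists_leaf : ∀ v ∈ R, v ∉ leaves → ∃ u ∈ leaves, center u = v ∧ Q v u

section StarCover

variable {V : Type*} {H F : SimpleGraph V} {Q : V → V → Prop} {R : Set V} {u v w : V}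

/-- The only useful edge of `F` at the vertex `v ∈ R` is `vu`. -/
def IsCritical (F : SimpleGraph V) (Q : V → V → Prop) (R : Set V) (v u : V) : Prop :=
  v ∈ R ∧ Q v u ∧ ∀ t, F.Adj v t → Q v t → t = u

theorem isCritical_or_isCritical_of_minimal
    (hF : Minimal (fun F : SimpleGraph V => F ≤ H ∧ ∀ v ∈ R, ∃ u, F.Adj v u ∧ Q v u) F)
    (h : F.Adj v u) : IsCritical F Q R v u ∨ IsCritical F Q R u v := by
  by_contra! hnot
  have hlt : F.deleteEdges {s(v, u)} < F :=
    (F.deleteEdges_le _).lt_of_ne fun heq => by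
      rw [← heq, SimpleGraph.deleteEdges_adj] at h
      exact h.2 rfl
  have survives : ∀ x ∈ R, ∃ t, (F.deleteEdges {s(v, u)}).Adj x t ∧ Q x t := by
    intro x hx
    obtain ⟨t, hadj, hQ⟩ := hF.prop.2 x hx
    by_cases ht : s(x, t) = s(v, u)
    · have hx : ¬ IsCritical F Q R x t := by
        rcases Sym2.eq_iff.1 ht with ⟨rfl, rfl⟩ | ⟨rfl, rfl⟩
        exacts [hnot.1, hnot.2]
      simp only [IsCritical, not_and, not_forall] at hx
      obtain ⟨t', hadj', hQ', hne⟩ := hx ‹_› hQ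
      refine ⟨t', ⟨hadj', fun heq => hne ?_⟩, hQ'⟩
      exact Sym2.congr_right.1 (heq.1.trans ht.symm)
    · exact ⟨t, ⟨hadj, fun heq => ht heq.1⟩, hQ⟩
  exact hF.not_prop_of_lt hlt ⟨hlt.le.trans hF.prop.1, survives⟩

/-- The vertex `v` becomes a leaf with center `s`: the edge `vs` is critical for `v`, and if it is
critical for both ends, then `v` is the smaller one. -/
def IsLeafOf [LT V] (F : SimpleGraph V) (Q : V → V → Prop) (R : Set V) (v s : V) : Prop :=
  F.Adj v s ∧ IsCritical F Q R v s ∧ (IsCritical F Q R s v → v < s)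

theorem IsLeafOf.center_unique [LT V] (h : IsLeafOf F Q R v u) (h' : IsLeafOf F Q R v w) : u = w :=
  h'.2.1.2.2 u h.1 h.2.1.2.1

theorem IsLeafOf.not_useful [Preorder V] (h : IsLeafOf F Q R v u) (h' : IsLeafOf F Q R u w) :
    ¬ Q u v := by
  intro hQ
  obtain rfl : v = w := h'.2.1.2.2 v h.1.symm hQ
  exact (h.2.2 h'.2.1).asymm (h'.2.2 h.2.1)

theorem isLeafOf_or_isLeafOf_of_minimal [LinearOrder V]
    (hF : Minimal (fun F : SimpleGraph V => F ≤ H ∧ ∀ v ∈ R, ∃ u, F.Adj v u ∧ Q v u) F)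
    (h : F.Adj v u) : IsLeafOf F Q R v u ∨ IsLeafOf F Q R u v := by
  have := isCritical_or_isCritical_of_minimal hF h
  have := h.ne.lt_or_gt
  have := h.symm
  unfold IsLeafOf
  tauto

-- Delete edges as long as every vertex of `R` keeps a useful edge.  Each remaining edge is critical
-- for one of its ends, so that a forest of stars remains.
theorem exists_starCover [Finite V] [LinearOrder V] (h : ∀ v ∈ R, ∃ u, H.Adj v u ∧ Q v u) :
    Nonempty (StarCover H Q R) := by
  classical
  cases nonempty_fintype V
  obtain ⟨F, hF⟩ := (Set.toFinite
    {F : SimpleGraph V | F ≤ H ∧ ∀ v ∈ R, ∃ u, F.Adj v u ∧ Q v u}).exists_minimal ⟨H, le_rfl, h⟩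
  have center_spec (v : V) : ∃ s, (∃ s, IsLeafOf F Q R v s) → IsLeafOf F Q R v s := by
    by_cases hv : ∃ s, IsLeafOf F Q R v s
    exacts [hv.imp fun s hs _ => hs, ⟨v, fun h => absurd h hv⟩]
  choose center hcenter using center_spec
  have isLeafOf_center {v : V} (hv : v ∈ ({v | ∃ s, IsLeafOf F Q R v s} : Finset V)) :
      IsLeafOf F Q R v (center v) := hcenter v (Finset.mem_filter.1 hv).2
  refine ⟨{ leaves := {v | ∃ s, IsLeafOf F Q R v s}
            center
            mem_of_leaf := fun v hv => (isLeafOf_center hv).2.1.1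
            adj_center := fun v hv => hF.prop.1 (isLeafOf_center hv).1
            useful_center := fun v hv => (isLeafOf_center hv).2.1.2.1
            not_useful_of_center_mem := fun v hv hc =>
              (isLeafOf_center hv).not_useful (isLeafOf_center hc)
            exists_leaf := fun v hv hnot => ?_ }⟩
  obtain ⟨u, hadj, hQ⟩ := hF.prop.2 v hv
  have hu : IsLeafOf F Q R u v := (isLeafOf_or_isLeafOf_of_minimal hF hadj).resolve_left
    fun h => hnot (Finset.mem_filter.2 ⟨Finset.mem_univ _, u, h⟩)
  have hmem : u ∈ ({v | ∃ s, IsLeafOf F Q R v s} : Finset V) :=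
    Finset.mem_filter.2 ⟨Finset.mem_univ _, v, hu⟩
  exact ⟨u, hmem, (isLeafOf_center hmem).center_unique hu, hQ⟩

/-- The leaves of a star cover that have a given center. -/
def StarCover.leavesAt [DecidableEq V] (S : StarCover H Q R) (s : V) : Finset V :=
  {u ∈ S.leaves | S.center u = s}

end StarCover

/-- Minimum-Power Edge-Multi-Cover with natural-number costs on an arbitrary vertex set. -/
structure CoverInstance (V : Type*) where
  graph : SimpleGraph V
  [decAdj : DecidableRel graph.Adj]
  cost : Sym2 V → ℕ
  req : V → ℕ

namespace CoverInstance

open Finset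

attribute [instance] CoverInstance.decAdj

variable {V : Type*} [Fintype V] [LinearOrder V] (N : CoverInstance V) {s t u v y : V}

/-- The edges at `v` are ordered by cost, with ties broken by the order of the vertices. -/
def key (v u : V) : ℕ ×ₗ V := toLex (N.cost s(v, u), u)

/-- The number of edges at `v` that precede `vu`. -/
def rank (v u : V) : ℕ := #{t ∈ N.graph.neighborFinset v | N.key v t < N.key v u}

theorem rank_lt_rank_iff (hu : N.graph.Adj v u) :
    N.rank v u < N.rank v t ↔ N.key v u < N.key v t := by
  refine ⟨fun h => lt_of_not_ge fun hle => h.not_ge ?_, fun h => card_lt_card ?_⟩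
  · exact card_le_card (monotone_filter_right _ fun x _ hx => hx.trans_le hle)
  · refine (monotone_filter_right _ fun x _ hx => hx.trans h).ssubset_of_not_subset fun hsub => ?_
    simpa using hsub (mem_filter.2 ⟨(N.graph.mem_neighborFinset v u).2 hu, h⟩)

theorem cost_le_cost_of_rank_le (ht : N.graph.Adj v t) (h : N.rank v u ≤ N.rank v t) :
    N.cost s(v, u) ≤ N.cost s(v, t) := by
  by_contra! hlt
  exact h.not_gt ((N.rank_lt_rank_iff ht).2 (Prod.Lex.toLex_lt_toLex.2 (.inl hlt)))

theorem rank_injOn (v : V) : Set.InjOn (N.rank v) (N.graph.neighborFinset v : Set V) := by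
  intro u hu t ht h
  have hu : N.graph.Adj v u := by simpa using hu
  have ht : N.graph.Adj v t := by simpa using ht
  have hkey : N.key v u = N.key v t := le_antisymm
    (not_lt.1 fun hlt => h.not_gt ((N.rank_lt_rank_iff ht).2 hlt))
    (not_lt.1 fun hlt => h.not_lt ((N.rank_lt_rank_iff hu).2 hlt))
  exact congrArg (fun q => (ofLex q).2) hkey

theorem image_rank (v : V) :
    (N.graph.neighborFinset v).image (N.rank v) = range (N.graph.degree v) := by
  refine eq_of_subset_of_card_le (image_subset_iff.2 fun u hu => ?_) ?_
  · refine mem_range.2 (card_lt_card (filter_ssubset.2 ⟨u, hu, lt_irrefl _⟩))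
  · rw [card_image_of_injOn (N.rank_injOn v), card_range, SimpleGraph.card_neighborFinset_eq_degree]

theorem card_rank_lt (v : V) (m : ℕ) :
    #{u ∈ N.graph.neighborFinset v | N.rank v u < m} = min m (N.graph.degree v) := by
  rw [← card_image_of_injOn ((N.rank_injOn v).mono (coe_subset.2 (filter_subset _ _))),
    ← filter_image (p := (· < m)), image_rank, ← card_range (min m _)]
  congr 1
  ext i
  simp [and_comm]

/-- The lower bound for the power of `v` in a feasible solution: the largest cost of the `req v`
first edges at `v`. -/
def weight (v : V) : ℕ :=
  ({u ∈ N.graph.neighborFinset v | N.rank v u < N.req v}).sup fun u => N.cost s(v, u)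

/-- The edge `vu` is not among the `req v - 1` first edges at `v`. -/
def Outside (v u : V) : Prop := N.req v ≤ N.rank v u + 1

instance : DecidableRel N.Outside := fun _ _ => inferInstanceAs (Decidable (_ ≤ _))

theorem cost_le_weight (hu : N.graph.Adj v u) (h : N.rank v u < N.req v) :
    N.cost s(v, u) ≤ N.weight v :=
  le_sup (f := fun u => N.cost s(v, u)) (by simp [hu, h])

theorem weight_le_cost (hu : N.graph.Adj v u) (h : N.Outside v u) :
    N.weight v ≤ N.cost s(v, u) :=
  Finset.sup_le fun _ ht => N.cost_le_cost_of_rank_le hu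
    (Nat.lt_succ_iff.1 ((mem_filter.1 ht).2.trans_le h))

theorem weight_eq_zero (h : N.req v = 0) : N.weight v = 0 := by
  simp [weight, h]

/-- Feasible solutions, as subgraphs. -/
structure IsCover (H : SimpleGraph V) : Prop where
  le : H ≤ N.graph
  req_le : ∀ v, N.req v ≤ (H.neighborSet v).ncard

variable {N} in
theorem IsCover.exists_outside {H : SimpleGraph V} (hH : N.IsCover H) (hv : 0 < N.req v) :
    ∃ u, H.Adj v u ∧ N.Outside v u := by
  have hlt : #{u ∈ N.graph.neighborFinset v | N.rank v u < N.req v - 1} <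
      (H.neighborSet v).ncard := by
    have := hH.req_le v
    rw [card_rank_lt]
    omega
  rw [← Set.ncard_coe_finset] at hlt
  obtain ⟨u, hu, hnot⟩ := Set.exists_mem_notMem_of_ncard_lt_ncard hlt
  refine ⟨u, hu, ?_⟩
  have := hH.le hu
  simp_all [Outside]

variable {N} in
theorem IsCover.weight_le {H : SimpleGraph V} (hH : N.IsCover H) {P : V → ℕ}
    (hP : ∀ v u, H.Adj v u → N.cost s(v, u) ≤ P v) (v : V) : N.weight v ≤ P v := by
  rcases (N.req v).eq_zero_or_pos with hv | hv
  · simp [N.weight_eq_zero hv]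
  · obtain ⟨u, hadj, hout⟩ := hH.exists_outside hv
    exact (N.weight_le_cost (hH.le hadj) hout).trans (hP v u hadj)

/-- The power that the center `s` of a star has if `y` is a leaf at maximal cost, and if `s` has
power `weight s` without the star. -/
def level (s y : V) : ℕ := max (N.cost s(s, y)) (N.weight s)

/-- The vertices outside of `c` that can be leaves of a star with center `s` whose most expensive
leaf is `y`. -/
def candidates (c : Finset V) (s y : V) : Finset V :=
  {u ∈ N.graph.neighborFinset s | u ∉ c ∧ N.Outside u s ∧ N.cost s(s, u) ≤ N.level s y}

/-- The weight that the star with center `s`, leaves `A` and most expensive leaf `y` adds to the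
set `c`. -/
def starGain (c : Finset V) (s y : V) (A : Finset V) : ℕ :=
  ∑ u ∈ A, N.weight u + if s ∉ c ∧ N.Outside s y then N.weight s else 0

/-- Twice the amount by which the star raises the powers of its vertices above their weights. -/
def starPrice (s y : V) (A : Finset V) : ℕ :=
  2 * (N.cost s(s, y) - N.weight s) + ∑ u ∈ A, 2 * (N.cost s(s, u) - N.weight u)

/-- The leaves of the star that maximizes the difference of gain and price: apart from `y`, those
candidates `u` with `2 * (cost - weight u) < weight u`. -/
def bestLeaves (c : Finset V) (s y : V) : Finset V :=
  {u ∈ N.candidates c s y | u = y ∨ 2 * N.cost s(s, u) < 3 * N.weight u}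

/-- No star with center `s` and most expensive leaf `y` gains more than its price. -/
def Exhausted (c : Finset V) (s y : V) : Prop :=
  ∀ A ⊆ N.candidates c s y, y ∈ A → N.starGain c s y A ≤ N.starPrice s y A

variable {N} {c c' : Finset V}

theorem mem_candidates : u ∈ N.candidates c s y ↔ N.graph.Adj s u ∧ u ∉ c ∧ N.Outside u s ∧
    N.cost s(s, u) ≤ N.level s y := by
  simp [candidates]

theorem candidates_anti (h : c ⊆ c') : N.candidates c' s y ⊆ N.candidates c s y := by
  intro u hu
  rw [mem_candidates] at hu ⊢
  exact ⟨hu.1, fun huc => hu.2.1 (h huc), hu.2.2⟩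

theorem Exhausted.mono (h : c ⊆ c') (hex : N.Exhausted c s y) : N.Exhausted c' s y := by
  refine fun A hA hy => le_trans ?_ (hex A (hA.trans (candidates_anti h)) hy)
  unfold starGain
  gcongr
  split_ifs with h₁ h₂
  exacts [le_rfl, absurd ⟨fun hs => h₁.1 (h hs), h₁.2⟩ h₂, Nat.zero_le _, le_rfl]

theorem exhausted_of_notMem_candidates (h : y ∉ N.candidates c s y) : N.Exhausted c s y :=
  fun _ hA hy => absurd (hA hy) h

theorem exhausted_of_starGain_bestLeaves_le
    (h : N.starGain c s y (N.bestLeaves c s y) ≤ N.starPrice s y (N.bestLeaves c s y)) :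
    N.Exhausted c s y := by
  intro A hA hy
  set B := N.bestLeaves c s y
  have keep : ∑ u ∈ B \ A, 2 * (N.cost s(s, u) - N.weight u) ≤ ∑ u ∈ B \ A, N.weight u := by
    refine sum_le_sum fun u hu => ?_
    obtain ⟨hB, huA⟩ := mem_sdiff.1 hu
    have := (mem_filter.1 hB).2.resolve_left fun h => huA (h ▸ hy)
    omega
  have drop : ∑ u ∈ A \ B, N.weight u ≤ ∑ u ∈ A \ B, 2 * (N.cost s(s, u) - N.weight u) := by
    refine sum_le_sum fun u hu => ?_
    obtain ⟨huA, hB⟩ := mem_sdiff.1 hu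
    have : ¬ 2 * N.cost s(s, u) < 3 * N.weight u := fun h => hB (mem_filter.2 ⟨hA huA, .inr h⟩)
    omega
  have split (f : V → ℕ) : ∑ u ∈ A, f u + ∑ u ∈ B \ A, f u = ∑ u ∈ B, f u + ∑ u ∈ A \ B, f u := by
    rw [add_comm, ← sum_union sdiff_disjoint, add_comm, ← sum_union sdiff_disjoint,
      sdiff_union_self_eq_union, sdiff_union_self_eq_union, union_comm]
  have := split N.weight
  have := split fun u => 2 * (N.cost s(s, u) - N.weight u)
  unfold starGain starPrice at *
  omega

section Uncovered

variable {H : SimpleGraph V} {P : V → ℕ}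

variable (S : StarCover H N.Outside {v | v ∉ c ∧ 0 < N.req v})

theorem leavesAt_subset_candidates (hH : H ≤ N.graph)
    (hy : ∀ u ∈ S.leavesAt s, N.cost s(s, u) ≤ N.cost s(s, y)) :
    S.leavesAt s ⊆ N.candidates c s y := by
  intro u hu
  obtain ⟨hleaf, rfl⟩ := mem_filter.1 hu
  exact mem_candidates.2 ⟨(hH (S.adj_center u hleaf)).symm, (S.mem_of_leaf u hleaf).1,
    S.useful_center u hleaf, (hy u hu).trans (le_max_left _ _)⟩

theorem sum_le_starGain (hy : ∀ u ∈ S.leavesAt s, N.rank s u ≤ N.rank s y) :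
    ∑ u ∈ S.leavesAt s, N.weight u + (if s ∉ c ∧ s ∉ S.leaves then N.weight s else 0) ≤
      N.starGain c s y (S.leavesAt s) := by
  refine Nat.add_le_add_left ?_ _
  split_ifs with h h' <;> try exact Nat.zero_le _
  · exact le_rfl
  · rcases (N.req s).eq_zero_or_pos with hs | hs
    · exact (N.weight_eq_zero hs).le
    · obtain ⟨u, hu, hcenter, hout⟩ := S.exists_leaf s ⟨h.1, hs⟩ h.2
      have hrank := hy u (mem_filter.2 ⟨hu, hcenter⟩)
      exact absurd ⟨h.1, hout.trans (Nat.succ_le_succ hrank)⟩ h'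

theorem starPrice_le_sum (hH : H ≤ N.graph) (hP : ∀ v u, H.Adj v u → N.cost s(v, u) ≤ P v)
    (hy : y ∈ S.leavesAt s) :
    N.starPrice s y (S.leavesAt s) ≤
      (if s ∉ S.leaves then 2 * (P s - N.weight s) else 0) +
        ∑ u ∈ S.leavesAt s, 2 * (P u - N.weight u) := by
  have hadj {u : V} (hu : u ∈ S.leavesAt s) : H.Adj u s :=
    (mem_filter.1 hu).2 ▸ S.adj_center u (mem_filter.1 hu).1
  refine Nat.add_le_add ?_ (sum_le_sum fun u hu => ?_)
  · split_ifs with hs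
    · obtain ⟨hleaf, rfl⟩ := mem_filter.1 hy
      have hnot := S.not_useful_of_center_mem y hleaf hs
      have := N.cost_le_weight (hH (hadj hy)).symm (by unfold Outside at hnot; omega)
      omega
    · have := hP s y (hadj hy).symm
      omega
  · have := hP u s (hadj hu)
    rw [Sym2.eq_swap] at this
    omega

theorem sum_leavesAt_le (hH : H ≤ N.graph) (hP : ∀ v u, H.Adj v u → N.cost s(v, u) ≤ P v)
    (hex : ∀ y, N.Exhausted c s y) :
    ∑ u ∈ S.leavesAt s, N.weight u + (if s ∉ c ∧ s ∉ S.leaves then N.weight s else 0) ≤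
      (if s ∉ S.leaves then 2 * (P s - N.weight s) else 0) +
        ∑ u ∈ S.leavesAt s, 2 * (P u - N.weight u) := by
  rcases (S.leavesAt s).eq_empty_or_nonempty with hempty | hne
  · have hs : s ∉ c → s ∉ S.leaves → N.req s = 0 := by
      intro hc hleaf
      by_contra hreq
      obtain ⟨u, hu, hcenter, -⟩ := S.exists_leaf s ⟨hc, Nat.pos_of_ne_zero hreq⟩ hleaf
      exact notMem_empty u (hempty ▸ mem_filter.2 ⟨hu, hcenter⟩)
    split_ifs with h <;> simp_all [N.weight_eq_zero]
  · obtain ⟨y, hy, hmax⟩ := exists_max_image _ (N.rank s) hne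
    have hadj : N.graph.Adj s y :=
      (mem_filter.1 hy).2 ▸ (hH (S.adj_center y (mem_filter.1 hy).1)).symm
    have hsub := leavesAt_subset_candidates S hH fun u hu =>
      N.cost_le_cost_of_rank_le hadj (hmax u hu)
    exact (sum_le_starGain S hmax).trans
      ((hex y _ hsub hy).trans (starPrice_le_sum S hH hP hy))

theorem IsCover.sum_uncovered_le (hH : N.IsCover H)
    (hP : ∀ v u, H.Adj v u → N.cost s(v, u) ≤ P v) (hex : ∀ s y, N.Exhausted c s y) :
    ∑ v ∈ cᶜ, N.weight v ≤ ∑ v, 2 * (P v - N.weight v) := by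
  obtain ⟨S⟩ := exists_starCover fun v (hv : v ∈ {v | v ∉ c ∧ 0 < N.req v}) =>
    hH.exists_outside hv.2
  calc ∑ v ∈ cᶜ, N.weight v
      ≤ ∑ v ∈ S.leaves, N.weight v + ∑ v with v ∉ c ∧ v ∉ S.leaves, N.weight v := by
        rw [← sum_union (disjoint_left.2 fun v hv hv' => (mem_filter.1 hv').2.2 hv)]
        refine sum_le_sum_of_subset fun v hv => ?_
        simp [mem_compl.1 hv, em]
    _ = ∑ s, (∑ u ∈ S.leavesAt s, N.weight u +
          if s ∉ c ∧ s ∉ S.leaves then N.weight s else 0) := by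
        rw [sum_add_distrib, sum_filter]
        congr 1
        exact (sum_fiberwise _ _ _).symm
    _ ≤ ∑ s, ((if s ∉ S.leaves then 2 * (P s - N.weight s) else 0) +
          ∑ u ∈ S.leavesAt s, 2 * (P u - N.weight u)) :=
        sum_le_sum fun s _ => sum_leavesAt_le S hH.le hP (hex s)
    _ = ∑ v ∈ S.leavesᶜ, 2 * (P v - N.weight v) + ∑ v ∈ S.leaves, 2 * (P v - N.weight v) := by
        rw [sum_add_distrib, ← sum_filter, filter_notMem_eq_sdiff, ← compl_eq_univ_sdiff]
        congr 1
        exact sum_fiberwise _ _ _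
    _ = ∑ v, 2 * (P v - N.weight v) := sum_compl_add_sum _ _

end Uncovered

variable {D : Finset (V × V)} {seen : Finset (V × V)} {p : V → ℕ}

variable (N) in
/-- Every vertex can pay with the powers `p` for the edges of `D` that are incident to it. -/
def Affords (p : V → ℕ) (D : Finset (V × V)) : Prop :=
  ∀ v u, (v, u) ∈ D → N.cost s(v, u) ≤ p v ∧ N.cost s(v, u) ≤ p u

variable (N) in
/-- The state of the greedy selection of stars: `D` is the set of selected edges, `c` is the set of
vertices `v` with a selected edge that is `N.Outside v`, and the stars with a center `s` and a most
expensive leaf `y` such that `(s, y) ∈ seen` have been treated. The powers for `D` exceed the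
weights by half of the weight of `c` at most. -/
structure Progress (c : Finset V) (D : Finset (V × V)) (seen : Finset (V × V)) : Prop where
  adj : ∀ v u, (v, u) ∈ D → N.graph.Adj v u
  exists_outside : ∀ v ∈ c, ∃ u, ((v, u) ∈ D ∨ (u, v) ∈ D) ∧ N.Outside v u
  exhausted : ∀ s y, (s, y) ∈ seen → N.Exhausted c s y
  affords : ∃ p, (∀ v, N.weight v ≤ p v) ∧ N.Affords p D ∧
    2 * ∑ v, p v ≤ 2 * ∑ v, N.weight v + ∑ v ∈ c, N.weight v

variable (N) in
theorem Progress.init : N.Progress ∅ ∅ ∅ where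
  adj := by simp
  exists_outside := by simp
  exhausted := by simp
  affords := ⟨N.weight, fun _ => le_rfl, by simp [Affords], by simp⟩

theorem Progress.insert_seen (h : N.Progress c D seen) (hex : N.Exhausted c s y) :
    N.Progress c D (insert (s, y) seen) where
  __ := h
  exhausted a b hab := by
    rcases mem_insert.1 hab with heq | hab
    · obtain ⟨rfl, rfl⟩ := Prod.mk.inj heq
      exact hex
    · exact h.exhausted a b hab

variable (N) in
/-- The set of covered vertices after the selection of the star with the leaves `bestLeaves c s y`
if `c` is the one before. -/
def coverStar (c : Finset V) (s y : V) : Finset V :=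
  c ∪ N.bestLeaves c s y ∪ ({s} : Finset V).filter (N.Outside · y)

variable (N) in
/-- The powers that pay for the star with the leaves `bestLeaves c s y` as well, if the powers `p`
are at least the weights. -/
def powerStar (p : V → ℕ) (c : Finset V) (s y : V) (v : V) : ℕ :=
  p v + (if v = s then N.cost s(s, y) - N.weight s else 0) +
    if v ∈ N.bestLeaves c s y then N.cost s(s, v) - N.weight v else 0

theorem bestLeaves_subset_candidates : N.bestLeaves c s y ⊆ N.candidates c s y :=
  filter_subset _ _

theorem mem_bestLeaves_self (hy : y ∈ N.candidates c s y) : y ∈ N.bestLeaves c s y :=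
  mem_filter.2 ⟨hy, .inl rfl⟩

theorem sum_coverStar :
    ∑ v ∈ N.coverStar c s y, N.weight v =
      ∑ v ∈ c, N.weight v + N.starGain c s y (N.bestLeaves c s y) := by
  have hc : Disjoint c (N.bestLeaves c s y) := disjoint_right.2 fun u hu =>
    (mem_candidates.1 (bestLeaves_subset_candidates hu)).2.1
  have hs : s ∉ N.bestLeaves c s y := fun h =>
    (mem_candidates.1 (bestLeaves_subset_candidates h)).1.ne rfl
  rw [coverStar, starGain, ← add_assoc, ← sum_union hc, filter_singleton]
  by_cases hout : N.Outside s y <;> by_cases hsc : s ∈ c <;>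
    simp [hout, hsc, hs, union_comm _ {s}, add_comm]

theorem sum_powerStar : 2 * ∑ v, N.powerStar p c s y v =
    2 * ∑ v, p v + N.starPrice s y (N.bestLeaves c s y) := by
  simp only [powerStar, starPrice, sum_add_distrib, sum_ite_eq', sum_ite_mem, mem_univ, if_true,
    univ_inter, mul_add, mul_sum, add_assoc]

theorem Affords.powerStar (hw : ∀ v, N.weight v ≤ p v) (hD : N.Affords p D) :
    N.Affords (N.powerStar p c s y) (D ∪ {s} ×ˢ N.bestLeaves c s y) := by
  intro v u hvu
  rcases mem_union.1 hvu with hvu | hvu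
  · have := hD v u hvu
    unfold CoverInstance.powerStar
    omega
  · obtain ⟨hv, hu⟩ := mem_product.1 hvu
    obtain rfl : v = s := mem_singleton.1 hv
    have hlevel := (mem_candidates.1 (bestLeaves_subset_candidates hu)).2.2.2
    have := hw v
    have := hw u
    simp only [CoverInstance.powerStar, if_true, hu, level, le_max_iff] at hlevel ⊢
    omega

theorem Progress.select (h : N.Progress c D seen) (hy : y ∈ N.candidates c s y)
    (hlt : N.starPrice s y (N.bestLeaves c s y) < N.starGain c s y (N.bestLeaves c s y)) :
    N.Progress (N.coverStar c s y) (D ∪ {s} ×ˢ N.bestLeaves c s y) seen where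
  adj v u hvu := by
    rcases mem_union.1 hvu with hvu | hvu
    · exact h.adj v u hvu
    · obtain ⟨hv, hu⟩ := mem_product.1 hvu
      obtain rfl : v = s := mem_singleton.1 hv
      exact (mem_candidates.1 (bestLeaves_subset_candidates hu)).1
  exists_outside v hv := by
    simp only [coverStar, mem_union, mem_filter, mem_singleton] at hv
    rcases hv with (hv | hv) | ⟨rfl, hout⟩
    · obtain ⟨u, hu, hout⟩ := h.exists_outside v hv
      exact ⟨u, hu.imp (mem_union_left _) (mem_union_left _), hout⟩
    · exact ⟨s, .inr (by simp [hv]),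
        (mem_candidates.1 (bestLeaves_subset_candidates hv)).2.2.1⟩
    · exact ⟨y, .inl (by simp [mem_bestLeaves_self hy]), hout⟩
  exhausted a b hab := (h.exhausted a b hab).mono (by simp [coverStar, union_assoc])
  affords := by
    obtain ⟨p, hw, hp, hsum⟩ := h.affords
    refine ⟨N.powerStar p c s y, fun v => ?_, hp.powerStar hw, ?_⟩
    · exact (hw v).trans (by simp [powerStar, add_assoc])
    · rw [sum_powerStar, sum_coverStar]
      omega

theorem Progress.select_seen (h : N.Progress c D seen) (hy : y ∈ N.candidates c s y)
    (hlt : N.starPrice s y (N.bestLeaves c s y) < N.starGain c s y (N.bestLeaves c s y)) :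
    N.Progress (N.coverStar c s y) (D ∪ {s} ×ˢ N.bestLeaves c s y) (insert (s, y) seen) :=
  (h.select hy hlt).insert_seen <| exhausted_of_notMem_candidates fun h =>
    (mem_candidates.1 h).2.1 (by simp [coverStar, mem_bestLeaves_self hy])

variable (N) in
/-- The number of first edges at `v` that complete the selection of stars. -/
def quota (c : Finset V) (v : V) : ℕ := if v ∈ c then N.req v - 1 else N.req v

variable (N) in
/-- The edges that complete the selection of stars to a feasible solution. -/
def completion (c : Finset V) : Finset (V × V) :=
  {q | N.graph.Adj q.1 q.2 ∧ N.rank q.1 q.2 < N.quota c q.1}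

theorem mem_completion :
    (v, u) ∈ N.completion c ↔ N.graph.Adj v u ∧ N.rank v u < N.quota c v := by
  simp [completion]

theorem IsCover.card_rank_lt_quota {H : SimpleGraph V} (hH : N.IsCover H) (v : V) :
    #{u ∈ N.graph.neighborFinset v | N.rank v u < N.quota c v} = N.quota c v := by
  have hdeg : N.req v ≤ N.graph.degree v := by
    rw [← SimpleGraph.card_neighborFinset_eq_degree, ← Set.ncard_coe_finset]
    exact (hH.req_le v).trans (Set.ncard_le_ncard fun u hu => by simpa using hH.le hu)
  rw [card_rank_lt, min_eq_left]
  unfold quota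
  split_ifs <;> omega

theorem Progress.adj_of_mem_union (h : N.Progress c D seen) (hvu : (v, u) ∈ D ∪ N.completion c) :
    N.graph.Adj v u :=
  (mem_union.1 hvu).elim (h.adj v u) fun hvu => (mem_completion.1 hvu).1

theorem Progress.isCover {H : SimpleGraph V} (hH : N.IsCover H) (h : N.Progress c D seen) :
    N.IsCover (.fromRel fun v u => (v, u) ∈ D ∪ N.completion c) where
  le _ _ hvu := hvu.2.elim h.adj_of_mem_union fun huv => (h.adj_of_mem_union huv).symm
  req_le v := by
    set K := SimpleGraph.fromRel fun v u => (v, u) ∈ D ∪ N.completion c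
    set A := {u ∈ N.graph.neighborFinset v | N.rank v u < N.quota c v} with hA
    have hAK : (A : Set V) ⊆ K.neighborSet v := fun u hu => by
      have hu : N.graph.Adj v u ∧ N.rank v u < N.quota c v := by simpa [hA] using hu
      exact ⟨hu.1.ne, .inl (mem_union_right _ (mem_completion.2 hu))⟩
    by_cases hv : v ∈ c
    · obtain ⟨u, hu, hout⟩ := h.exists_outside v hv
      have hadj : N.graph.Adj v u := hu.elim (h.adj v u) fun h' => (h.adj u v h').symm
      have huA : u ∉ A := by
        have : N.req v ≤ N.rank v u + 1 := hout
        simp only [hA, mem_filter, quota, hv, if_true]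
        omega
      have hinsert : ((insert u A : Finset V) : Set V) ⊆ K.neighborSet v := by
        rw [coe_insert, Set.insert_subset_iff]
        exact ⟨⟨hadj.ne, hu.imp (mem_union_left _) (mem_union_left _)⟩, hAK⟩
      have hcard := Set.ncard_le_ncard hinsert
      rw [Set.ncard_coe_finset, card_insert_of_notMem huA, hH.card_rank_lt_quota, quota,
        if_pos hv] at hcard
      omega
    · have hcard := Set.ncard_le_ncard hAK
      rwa [Set.ncard_coe_finset, hH.card_rank_lt_quota, quota, if_neg hv] at hcard

theorem sum_completion_le (v : V) :
    ∑ u, (if (v, u) ∈ N.completion c then N.cost s(v, u) else 0) ≤ N.quota c v * N.weight v := by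
  have hquota : N.quota c v ≤ N.req v := by unfold quota; split_ifs <;> omega
  calc ∑ u, (if (v, u) ∈ N.completion c then N.cost s(v, u) else 0)
      = ∑ u ∈ N.graph.neighborFinset v with N.rank v u < N.quota c v, N.cost s(v, u) := by
        rw [← sum_filter]
        exact sum_congr (by ext u; simp [mem_completion]) fun _ _ => rfl
    _ ≤ #{u ∈ N.graph.neighborFinset v | N.rank v u < N.quota c v} • N.weight v :=
        sum_le_card_nsmul _ _ _ fun u hu => by
          obtain ⟨hadj, hrank⟩ := mem_filter.1 hu
          exact N.cost_le_weight (by simpa using hadj) (hrank.trans_le hquota)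
    _ ≤ N.quota c v * N.weight v := by
        rw [card_rank_lt, smul_eq_mul]
        exact Nat.mul_le_mul_right _ (min_le_left _ _)

theorem Affords.completion (hw : ∀ v, N.weight v ≤ p v) (hD : N.Affords p D) :
    N.Affords (fun u => p u + ∑ v, if (v, u) ∈ N.completion c then N.cost s(v, u) else 0)
      (D ∪ N.completion c) := by
  intro v u hvu
  rcases mem_union.1 hvu with hvu | hvu
  · exact (hD v u hvu).imp le_add_right le_add_right
  · obtain ⟨hadj, hrank⟩ := mem_completion.1 hvu
    have hquota : N.quota c v ≤ N.req v := by unfold quota; split_ifs <;> omega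
    refine ⟨le_add_right ((N.cost_le_weight hadj (hrank.trans_le hquota)).trans (hw v)),
      le_add_left ?_⟩
    simpa [hvu] using single_le_sum (f := fun v => if (v, u) ∈ N.completion c then N.cost s(v, u)
      else 0) (fun _ _ => Nat.zero_le _) (mem_univ v)

theorem quota_mul_weight_le {k : ℕ} (hk : ∀ v, N.req v ≤ k) :
    ∑ v ∈ c, N.weight v + 2 * ∑ v, (N.quota c v + 1) * N.weight v ≤
      (2 * k + 1) * ∑ v, N.weight v + ∑ v ∈ cᶜ, N.weight v := by
  rw [← sum_compl_add_sum c fun v => (N.quota c v + 1) * N.weight v,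
    ← sum_compl_add_sum c N.weight]
  have covered : ∑ v ∈ c, (N.quota c v + 1) * N.weight v ≤ k * ∑ v ∈ c, N.weight v := by
    rw [mul_sum]
    refine sum_le_sum fun v hv => ?_
    rcases (N.req v).eq_zero_or_pos with hreq | hreq
    · simp [N.weight_eq_zero hreq]
    · have := hk v
      exact Nat.mul_le_mul_right _ (by rw [quota, if_pos hv]; omega)
  have uncovered : ∑ v ∈ cᶜ, (N.quota c v + 1) * N.weight v ≤ (k + 1) * ∑ v ∈ cᶜ, N.weight v := by
    rw [mul_sum]
    refine sum_le_sum fun v hv => Nat.mul_le_mul_right _ ?_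
    rw [quota, if_neg (mem_compl.1 hv)]
    exact Nat.succ_le_succ (hk v)
  linarith

theorem Progress.exists_affords {k : ℕ} (h : N.Progress c D seen) (hk : ∀ v, N.req v ≤ k) :
    ∃ p, N.Affords p (D ∪ N.completion c) ∧
      2 * ∑ v, p v ≤ (2 * k + 1) * ∑ v, N.weight v + ∑ v ∈ cᶜ, N.weight v := by
  obtain ⟨p, hw, hp, hsum⟩ := h.affords
  refine ⟨_, hp.completion hw, ?_⟩
  have hextra := sum_le_sum fun v (_ : v ∈ univ) => sum_completion_le (N := N) (c := c) v
  have hquota := quota_mul_weight_le (c := c) hk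
  simp only [add_mul, one_mul, sum_add_distrib] at hquota ⊢
  rw [sum_comm]
  omega

theorem IsCover.exists_affords_le {H : SimpleGraph V} {P : V → ℕ} {k : ℕ} (hH : N.IsCover H)
    (hP : ∀ v u, H.Adj v u → N.cost s(v, u) ≤ P v) (hk : ∀ v, N.req v ≤ k)
    (h : N.Progress c D univ) :
    ∃ p, N.Affords p (D ∪ N.completion c) ∧ 2 * ∑ v, p v ≤ (2 * k + 1) * ∑ v, P v := by
  obtain ⟨p, hp, hsum⟩ := h.exists_affords hk
  refine ⟨p, hp, hsum.trans ?_⟩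
  rcases k with _ | j
  · simp [fun v => N.weight_eq_zero (Nat.le_zero.1 (hk v))]
  · have huncovered := hH.sum_uncovered_le hP fun s y => h.exhausted s y (mem_univ _)
    have hsplit : ∑ v, 2 * (P v - N.weight v) + 2 * ∑ v, N.weight v = 2 * ∑ v, P v := by
      rw [← mul_sum, ← mul_add, ← sum_add_distrib]
      simp only [Nat.sub_add_cancel (hH.weight_le hP _)]
    have hle := Nat.mul_le_mul_left (2 * j + 1)
      (sum_le_sum fun v (_ : v ∈ univ) => hH.weight_le hP v)
    linarith

end CoverInstance

namespace RAM

local notation "rSize" => 0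
local notation "rCells" => 1
local notation "rCell" => 2
local notation "rCellOff" => 3
local notation "rFactor" => 4
local notation "rFactorOff" => 5
local notation "rLeft" => 6
local notation "rRight" => 7
local notation "rProd" => 8
local notation "rV" => 10
local notation "rVOff" => 11
local notation "rU" => 12
local notation "rUOff" => 13
local notation "rT" => 14
local notation "rTOff" => 15
local notation "rRank" => 16
local notation "rGain" => 17
local notation "rPrice" => 18

local notation "aReq" => 0
local notation "aCost" => 1
local notation "aAdj" => 2
local notation "aArc" => 3
local notation "aRank" => 4
local notation "aWeight" => 5
local notation "aCovered" => 6

open RAM.Expr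

/-- Binary multiplication of the registers `rLeft` and `rRight` into `rProd`. -/
def mulProg : Program :=
  .assign rProd 0 ;; .loop (.reg rRight)
    (.when (.lt (half (.reg rRight) + half (.reg rRight)) (.reg rRight))
        (.assign rProd (.reg rProd + .reg rLeft)) ;;
      .assign rLeft (.reg rLeft + .reg rLeft) ;; .assign rRight (half (.reg rRight)))

theorem runs_mulProg {M : ℕ} {s : State} (hM : (s.reg rRight).size ≤ M) :
    Runs M mulProg s fun s' => s'.reg rProd = s.reg rLeft * s.reg rRight := by
  refine .seq (.assign (.mono (.loop hM (fun i s' => s'.reg rRight = s.reg rRight / 2 ^ i ∧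
    s'.reg rProd + s'.reg rLeft * s'.reg rRight = s.reg rLeft * s.reg rRight) ?_ ?_ ?_) ?_))
  · simp
  · rintro i hi s' - ⟨hbits, hprod⟩
    have hhalf : s'.reg rRight / 2 = s.reg rRight / 2 ^ (i + 1) := by
      rw [hbits, Nat.div_div_eq_div_mul, pow_succ]
    have hpos : (reg rRight).IsTrue s' := by
      simp only [IsTrue, eval_reg, hbits]
      exact (Nat.div_pos (Nat.lt_size.1 hi) (by positivity)).ne'
    refine ⟨hpos, .seq (.when (p := s'.reg rRight = 2 * (s'.reg rRight / 2) + 1)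
      (by simp; omega) (fun hodd => ?_) fun heven => ?_)⟩
    · refine .assign (.seq (.assign (.assign ⟨by simpa using hhalf, ?_⟩)))
      simp only [State.setReg_reg, eval_add, eval_half, eval_reg, Nat.reduceEqDiff, reduceIte]
      conv_rhs => rw [← hprod, hodd]
      ring
    · refine .seq (.assign (.assign ⟨by simpa using hhalf, ?_⟩))
      have heven : s'.reg rRight = 2 * (s'.reg rRight / 2) := by omega
      simp only [State.setReg_reg, eval_add, eval_half, eval_reg, Nat.reduceEqDiff, reduceIte]
      conv_rhs => rw [← hprod, heven]
      ring
  · rintro s' - ⟨hbits, -⟩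
    simpa [IsTrue, hbits] using Nat.lt_size_self _
  · rintro s' - ⟨hbits, hprod⟩
    rw [Nat.div_eq_of_lt (Nat.lt_size_self _)] at hbits
    simpa [hbits] using hprod

/-- Multiplication of cell `rCell` of the costs by cell `rFactor` of the denominators. -/
def scaleStep : Program :=
  .assign rLeft (get aCost (.reg rCell)) ;; .assign rRight (get aAdj (.reg rFactor)) ;; mulProg ;;
    .store aCost (.reg rCell) (.reg rProd)

/-- Multiplication of every cost by the nonzero denominators of the other ones. -/
def scaleProg : Program :=
  .forLoop rCells rCell rCellOff (.forLoop rCells rFactor rFactorOff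
    (.when (.and (get aAdj (.reg rFactor)) (.not (.eq (.reg rCell) (.reg rFactor)))) scaleStep))

theorem runs_scaleStep {M : ℕ} {s : State} (hM : (s.arr aAdj (s.reg rFactor)).size ≤ M) :
    Runs M scaleStep s fun s' => s'.arr aCost = Function.update (s.arr aCost) (s.reg rCell)
      (s.arr aCost (s.reg rCell) * s.arr aAdj (s.reg rFactor)) := by
  refine .seq (.assign (.seq (.assign (.seq ((runs_mulProg (by simpa using hM)).mono
    fun s' hf hprod => .store ?_)))))
  have hcell : s'.reg rCell = s.reg rCell := hf.reg rCell rfl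
  have hcost : s'.arr aCost = s.arr aCost := hf.arr aCost rfl
  simpa [hcell, hcost] using congrArg _ hprod

/-- The factor that cell `q` of the denominators `d` contributes to the cost in cell `m`. -/
def scaleFactorAt (d : ℕ → ℕ) (m q : ℕ) : ℕ := if d q ≠ 0 ∧ m ≠ q then d q else 1

theorem prod_scaleFactorAt_mul {d : ℕ → ℕ} {n : ℕ} {m : Fin n} (hm : d m ≠ 0) :
    (∏ q : Fin n, scaleFactorAt d m q) * d m = ∏ q : Fin n, if d q ≠ 0 then d q else 1 := by
  rw [← Fintype.prod_ite_eq m fun q => d q, ← Finset.prod_mul_distrib]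
  refine Finset.prod_congr rfl fun q _ => ?_
  rcases eq_or_ne m q with rfl | hq
  · simp [scaleFactorAt, hm]
  · simp [scaleFactorAt, hq, Fin.val_ne_of_ne hq]

theorem runs_scaleProg {M n : ℕ} {s : State} (hn : s.reg rCells = n) (hM : n ≤ M)
    (hsize : ∀ q < n, (s.arr aAdj q).size ≤ M) :
    Runs M scaleProg s fun s' => ∀ m < n, s'.arr aCost m =
      s.arr aCost m * ∏ q : Fin n, scaleFactorAt (s.arr aAdj) m q := by
  refine (Runs.forLoop hn (by decide) hM (fun A s' => ∀ m : Fin n, s'.arr aCost m =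
    s.arr aCost m * if m ∈ A then ∏ q : Fin n, scaleFactorAt (s.arr aAdj) m q else 1)
    (fun _ _ _ _ h => h) (by simp) fun m A s₁ hm hf₁ hrow₁ hA => ?_).mono
    fun s' _ h m hm => by simpa using h.1 ⟨m, hm⟩
  refine (Runs.forLoop ((hf₁.reg rCells rfl).trans hn) (by decide) hM
    (fun B s' => s'.arr aCost = Function.update (s₁.arr aCost) m
      (s.arr aCost m * ∏ q ∈ B, scaleFactorAt (s.arr aAdj) m q))
    (fun _ _ _ _ h => h) ?_ fun q B s₂ hq hf₂ hrow₂ hB => ?_).mono fun s' _ h m' => ?_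
  · have := hA m
    rw [if_neg hm] at this
    simp [← this]
  · have hcell : s₂.reg rCell = m := (hf₂.reg rCell rfl).trans hrow₁.index
    have hden : s₂.arr aAdj = s.arr aAdj := (hf₂.arr aAdj rfl).trans (hf₁.arr aAdj rfl)
    refine .when (p := s.arr aAdj q ≠ 0 ∧ (m : ℕ) ≠ q) (by simp [hcell, hrow₂.index, hden])
      (fun hp => (runs_scaleStep ?_).mono fun s' _ h => ?_) fun hp => ?_
    · rw [hden, hrow₂.index]
      exact hsize q q.2
    · rw [Finset.prod_insert hq, scaleFactorAt, if_pos hp, h, hcell, hrow₂.index, hden, hB]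
      simp [mul_left_comm, mul_comm]
    · rw [Finset.prod_insert hq, scaleFactorAt, if_neg hp, one_mul, hB]
  · rw [h.1]
    by_cases hmm : m' = m
    · simp [hmm]
    · have : (m' : ℕ) ≠ m := fun h => hmm (Fin.ext h)
      simp [hA m', hmm, this]

/-- The scaling of the costs in the memory, after the computation of the number of cells. -/
def prepareProg : Program := .forLoop rSize rCell rCells .noop ;; scaleProg

theorem runs_prepareProg {M n : ℕ} {s : State} (hn : s.reg rSize = n) (hM : n * n ≤ M)
    (hsize : ∀ q < n * n, (s.arr aAdj q).size ≤ M) :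
    Runs M prepareProg s fun s' => ∀ m < n * n, s'.arr aCost m =
      s.arr aCost m * ∏ q : Fin (n * n), scaleFactorAt (s.arr aAdj) m q := by
  refine .seq ((Runs.forLoop hn (by decide) ((Nat.le_mul_self n).trans hM) (fun _ _ => True)
    (fun _ _ _ _ _ => trivial) trivial fun _ _ _ _ _ _ _ => .noop trivial).mono
    fun s₁ hf₁ ⟨_, hcells⟩ => ?_)
  have hden : s₁.arr aAdj = s.arr aAdj := hf₁.arr aAdj rfl
  have hcost : s₁.arr aCost = s.arr aCost := hf₁.arr aCost rfl
  exact hden ▸ hcost ▸ runs_scaleProg hcells hM (hden ▸ hsize)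

section Matrices

variable {n : ℕ}

theorem cell_eq_cell_iff {v u v' u' : Fin n} :
    (v * n + u : ℕ) = v' * n + u' ↔ v = v' ∧ u = u' := by
  rw [← Prod.mk.injEq, ← (finProdFinEquiv (m := n) (n := n)).injective.eq_iff, Fin.ext_iff]
  simp [add_comm, mul_comm]

/-- The array `f` holds the indicator function of the set `c`. -/
def Marks (c : Finset (Fin n)) (f : ℕ → ℕ) : Prop := ∀ v : Fin n, f v ≠ 0 ↔ v ∈ c

theorem Marks.insert {c : Finset (Fin n)} {f : ℕ → ℕ} (h : Marks c f) (v : Fin n) :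
    Marks (insert v c) (Function.update f v 1) := by
  intro u
  rcases eq_or_ne u v with rfl | hu
  · simp
  · rw [Function.update_of_ne (Fin.val_ne_of_ne hu), h u, Finset.mem_insert, or_iff_right hu]

/-- The array `f` holds the adjacency matrix of the relation `D`. -/
def Selects (D : Finset (Fin n × Fin n)) (f : ℕ → ℕ) : Prop :=
  ∀ v u : Fin n, f (v * n + u) ≠ 0 ↔ (v, u) ∈ D

theorem Selects.insert {D : Finset (Fin n × Fin n)} {f : ℕ → ℕ} (h : Selects D f) (v u : Fin n) :
    Selects (insert (v, u) D) (Function.update f (v * n + u) 1) := by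
  intro v' u'
  simp only [Function.update_apply, cell_eq_cell_iff, Finset.mem_insert, Prod.mk.injEq]
  split_ifs with heq
  · simp [heq]
  · simp [heq, h v' u']

end Matrices

/-- The loop over all vertices `rT`. -/
def forNodes (P : Program) : Program := .forLoop rSize rT rTOff P

/-- The loop over all pairs of vertices `rV` and `rU`. -/
def forPairs (P : Program) : Program := .forLoop rSize rV rVOff (.forLoop rSize rU rUOff P)

theorem Runs.forPairs {M n : ℕ} {P : Program} {s : State} (hn : s.reg rSize = n)
    (hP : ∀ x ∈ [rSize, rV, rVOff, rU, rUOff], P.writesReg x = false) (hM : n ≤ M)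
    (Inv : Finset (Fin n × Fin n) → (ℕ → ℕ → ℕ) → Prop) (init : Inv ∅ s.arr)
    (step : ∀ v u seen s', (v, u) ∉ seen → Frame (forPairs P) s s' → AtRow s' rV rVOff v →
      AtRow s' rU rUOff u → Inv seen s'.arr →
        Runs M P s' fun s'' => Inv (insert (v, u) seen) s''.arr) :
    Runs M (forPairs P) s fun s' => Inv Finset.univ s'.arr := by
  have inner : (P.forLoop rSize rU rUOff).IsForBody rSize rV rVOff := by
    simp_all [Program.IsForBody, Program.forLoop, Program.writesReg]
  refine (Runs.forLoop hn inner hM (fun A s' => Inv (A ×ˢ .univ) s'.arr) (fun _ _ _ _ h => h)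
    (by simpa using init) fun v A s₁ hv hf₁ hrow₁ hA => ?_).mono fun s' _ h => by simpa using h.1
  refine (Runs.forLoop ((hf₁.reg rSize ?_).trans hn) ⟨by decide, by simp_all⟩ hM
    (fun B s' => Inv (A ×ˢ .univ ∪ {v} ×ˢ B) s'.arr) (fun _ _ _ _ h => h) (by simpa using hA)
    fun u B s₂ hu hf₂ hrow₂ hB => ?_).mono fun s' _ h => ?_
  · simp_all [Program.forLoop, Program.writesReg]
  · refine (step v u _ s₂ (by simp [hv, hu]) (hf₁.trans (hf₂.mono ?_ ?_))
      ⟨?_, ?_⟩ hrow₂ hB).mono fun s'' _ h => ?_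
    · simp_all [Program.forLoop, Program.writesReg]
    · simp_all [Program.forLoop, Program.writesArr]
    · exact (hf₂.reg rV (inner.2 rV (by simp))).trans hrow₁.index
    · exact (hf₂.reg rVOff (inner.2 rVOff (by simp))).trans hrow₁.offset
    · convert h using 1
      ext ⟨a, b⟩
      simp only [Finset.mem_insert, Finset.mem_union, Finset.mem_product, Finset.mem_univ,
        Finset.mem_singleton, Prod.mk.injEq]
      tauto
  · convert h.1 using 1
    ext ⟨a, b⟩
    simp [eq_comm, or_comm]

/-- The memory holds the instance `N`. -/
structure Holds {n : ℕ} (N : CoverInstance (Fin n)) (s : State) : Prop where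
  size : s.reg rSize = n
  req : ∀ v : Fin n, s.arr aReq v = N.req v
  cost : ∀ v u : Fin n, s.arr aCost (v * n + u) = N.cost s(v, u)
  adj : ∀ v u : Fin n, s.arr aAdj (v * n + u) ≠ 0 ↔ N.graph.Adj v u

/-- The entry in row `b` and column `x` of a matrix, where register `b` holds the offset of the
row. -/
def cell (a b x : ℕ) : Expr := get a (reg b + reg x)

section Rank

variable {M n : ℕ} {N : CoverInstance (Fin n)} {s s' : State} {P : Program} {x b : ℕ}
  {v u t : Fin n}

theorem Holds.of_frame (H : Holds N s) (hf : Frame P s s') (hP : P.writesReg rSize = false ∧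
    ∀ a ∈ [aReq, aCost, aAdj], P.writesArr a = false := by decide) : Holds N s' where
  size := (hf.reg rSize hP.1).trans H.size
  req v := hf.arr aReq (hP.2 _ (by simp)) ▸ H.req v
  cost v u := hf.arr aCost (hP.2 _ (by simp)) ▸ H.cost v u
  adj v u := hf.arr aAdj (hP.2 _ (by simp)) ▸ H.adj v u

theorem AtRow.of_frame (h : AtRow s x b v) (hf : Frame P s s')
    (hP : P.writesReg x = false ∧ P.writesReg b = false := by decide) : AtRow s' x b v :=
  ⟨(hf.reg x hP.1).trans h.index, (hf.reg b hP.2).trans h.offset⟩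

/-- The test whether, at the vertex `rV`, the edge to `rT` precedes the edge to `rU`. -/
def precedesTest : Expr :=
  .and (cell aAdj rVOff rT) (.or (.lt (cell aCost rVOff rT) (cell aCost rVOff rU))
    (.and (.eq (cell aCost rVOff rT) (cell aCost rVOff rU)) (.lt (reg rT) (reg rU))))

theorem isTrue_precedesTest (H : Holds N s) (hv : AtRow s rV rVOff v) (hu : AtRow s rU rUOff u)
    (ht : AtRow s rT rTOff t) :
    precedesTest.IsTrue s ↔ t ∈ N.graph.neighborFinset v ∧ N.key v t < N.key v u := by
  simp [precedesTest, cell, CoverInstance.key, hv.offset, hu.index, ht.index, H.cost, H.adj,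
    Prod.Lex.toLex_lt_toLex]

/-- The computation of the rank of the edge from `rV` to `rU`. -/
def countProg : Program :=
  .assign rRank 0 ;; forNodes (.when precedesTest (.assign rRank (reg rRank + 1)))

theorem runs_countProg (H : Holds N s) (hM : n ≤ M) (hv : AtRow s rV rVOff v)
    (hu : AtRow s rU rUOff u) : Runs M countProg s fun s' => s'.reg rRank = N.rank v u := by
  refine .seq (.mono (.assign (Q := fun s' => s'.reg rRank = 0) rfl) fun s₁ hf₁ hzero => ?_)
  have H₁ := H.of_frame hf₁
  refine (Runs.forLoop H₁.size (by decide) hM (fun A s' => s'.reg rRank =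
    Finset.card {t ∈ A | t ∈ N.graph.neighborFinset v ∧ N.key v t < N.key v u}) (by simp)
    (by simpa using hzero) fun t A s₂ ht hf₂ hrow hA => .when
      (isTrue_precedesTest (H₁.of_frame hf₂) ((hv.of_frame hf₁).of_frame hf₂)
        ((hu.of_frame hf₁).of_frame hf₂) hrow) (fun hp => .assign ?_) fun hp => ?_).mono
    fun s' _ h => ?_
  · rw [Finset.filter_insert, if_pos hp, Finset.card_insert_of_notMem (by simp [ht])]
    simp [hA]
  · rw [Finset.filter_insert, if_neg hp, hA]
  · rw [h.1, CoverInstance.rank, ← Finset.filter_filter, Finset.filter_univ_mem]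

/-- The computation of the ranks of all edges. -/
def rankProg : Program := forPairs (countProg ;; .store aRank (reg rVOff + reg rU) (reg rRank))

theorem runs_rankProg (H : Holds N s) (hM : n ≤ M) :
    Runs M rankProg s fun s' => ∀ v u : Fin n, s'.arr aRank (v * n + u) = N.rank v u := by
  refine (Runs.forPairs H.size (by decide) hM
    (fun seen f => ∀ v u : Fin n, (v, u) ∈ seen → f aRank (v * n + u) = N.rank v u) (by simp)
    fun v u seen s₁ _ hf₁ hv hu hseen => .seq ((runs_countProg (H.of_frame hf₁) hM hv hu).mono
      fun s₂ hf₂ hrank => .store fun v' u' h => ?_)).mono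
        fun s' _ h v u => h v u (Finset.mem_univ _)
  simp only [eval_add, eval_reg, hf₂.reg rVOff rfl, hf₂.reg rU rfl, hv.offset, hu.index, hrank,
    State.setArr_arr, if_true, Function.update_apply, cell_eq_cell_iff, hf₂.arr aRank rfl]
  split_ifs with heq
  · rw [heq.1, heq.2]
  · exact hseen v' u' ((Finset.mem_insert.1 h).resolve_left fun h => heq (Prod.mk.inj h))

end Rank

section Weight

variable {M n : ℕ} {N : CoverInstance (Fin n)} {s s' : State} {P : Program}

/-- The memory holds the instance `N` together with the ranks of its edges and the weights of its
vertices. -/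
structure Ranked {n : ℕ} (N : CoverInstance (Fin n)) (s : State) : Prop extends Holds N s where
  rank : ∀ v u : Fin n, s.arr aRank (v * n + u) = N.rank v u
  weight : ∀ v : Fin n, s.arr aWeight v = N.weight v

theorem Ranked.of_frame (R : Ranked N s) (hf : Frame P s s') (hP : P.writesReg rSize = false ∧
    ∀ a ∈ [aReq, aCost, aAdj, aRank, aWeight], P.writesArr a = false := by decide) :
    Ranked N s' where
  toHolds := R.toHolds.of_frame hf (by simp_all)
  rank v u := hf.arr aRank (hP.2 _ (by simp)) ▸ R.rank v u
  weight v := hf.arr aWeight (hP.2 _ (by simp)) ▸ R.weight v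

/-- The computation of the weights of all vertices. -/
def weightProg : Program :=
  forPairs (.when (.and (cell aAdj rVOff rU) (.lt (cell aRank rVOff rU) (get aReq (reg rV))))
    (.store aWeight (reg rV) (.max (get aWeight (reg rV)) (cell aCost rVOff rU))))

theorem runs_weightProg (H : Holds N s) (hM : n ≤ M) (hzero : ∀ v : Fin n, s.arr aWeight v = 0)
    (hrank : ∀ v u : Fin n, s.arr aRank (v * n + u) = N.rank v u) :
    Runs M weightProg s (Ranked N) := by
  refine (Runs.forPairs H.size (by decide) hM (fun seen f => ∀ v : Fin n, f aWeight v =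
    ({u ∈ N.graph.neighborFinset v | N.rank v u < N.req v ∧ (v, u) ∈ seen} : Finset _).sup
      fun u => N.cost s(v, u)) (by simpa using hzero)
    fun v u seen s₁ _ hf₁ hv hu hseen => ?_).mono fun s' hf h =>
    ⟨H.of_frame hf, by rwa [hf.arr aRank rfl], fun v => by simp [h v, CoverInstance.weight]⟩
  have H₁ := H.of_frame hf₁
  have hrank₁ := hf₁.arr aRank rfl ▸ hrank
  refine .when (p := N.graph.Adj v u ∧ N.rank v u < N.req v)
    (by simp [cell, hv.index, hv.offset, hu.index, H₁.adj, H₁.req, hrank₁])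
    (fun hp => .store fun v' => ?_) fun hp v' => ?_
  · simp only [State.setArr_arr, if_true, Function.update_apply, eval_max, eval_get, eval_reg,
      hv.index, Fin.val_inj, cell, eval_add, hv.offset, hu.index, H₁.cost]
    split_ifs with heq
    · subst heq
      rw [hseen, max_comm]
      refine (Finset.sup_insert (f := fun u => N.cost s(v', u))).symm.trans ?_
      congr 1
      ext u'
      simp only [Finset.mem_filter, Finset.mem_insert, SimpleGraph.mem_neighborFinset,
        Prod.mk.injEq]
      grind
    · rw [hseen]
      simp [heq]
  · rw [hseen]
    congr 1
    ext u'
    simp only [Finset.mem_filter, Finset.mem_insert, SimpleGraph.mem_neighborFinset, Prod.mk.injEq]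
    grind

end Weight

section Star

variable {M n : ℕ} {N : CoverInstance (Fin n)} {s : State} {x b z : ℕ} {v u t : Fin n}
  {c : Finset (Fin n)} {D : Finset (Fin n × Fin n)}

/-- The test whether the edge from `x` to `z` is outside of the first edges at `x`. -/
def outsideTest (x b z : ℕ) : Expr := .le (get aReq (reg x)) (cell aRank b z + 1)

/-- The test whether the vertex `x` is a candidate for a leaf of the star with center `rV` and
most expensive leaf `rU`. -/
def candidateTest (x b : ℕ) : Expr :=
  .and (cell aAdj rVOff x) (.and (.not (get aCovered (reg x))) (.and (outsideTest x b rV)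
    (.le (cell aCost rVOff x) (.max (cell aCost rVOff rU) (get aWeight (reg rV))))))

/-- The test whether the vertex `rT` is one of the best leaves of this star. -/
def bestTest : Expr :=
  .and (candidateTest rT rTOff) (.or (.eq (reg rT) (reg rU))
    (.lt (cell aCost rVOff rT + cell aCost rVOff rT)
      (get aWeight (reg rT) + (get aWeight (reg rT) + get aWeight (reg rT)))))

theorem isTrue_outsideTest (R : Ranked N s) (hv : AtRow s x b v) (hu : s.reg z = u) :
    (outsideTest x b z).IsTrue s ↔ N.Outside v u := by
  simp [outsideTest, cell, CoverInstance.Outside, hv.index, hv.offset, hu, R.req, R.rank]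

theorem isTrue_candidateTest (R : Ranked N s) (hv : AtRow s rV rVOff v) (hu : AtRow s rU rUOff u)
    (ht : AtRow s x b t) (hc : s.arr aCovered t ≠ 0 ↔ t ∈ c) :
    (candidateTest x b).IsTrue s ↔ t ∈ N.candidates c v u := by
  simp [candidateTest, isTrue_outsideTest R ht hv.index, cell, hv.index, hv.offset, hu.index,
    ht.index, R.adj, R.cost, R.weight, not_iff_not.2 hc, CoverInstance.mem_candidates,
    CoverInstance.level]

theorem isTrue_bestTest (R : Ranked N s) (hv : AtRow s rV rVOff v) (hu : AtRow s rU rUOff u)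
    (ht : AtRow s rT rTOff t) (hc : s.arr aCovered t ≠ 0 ↔ t ∈ c) :
    bestTest.IsTrue s ↔ t ∈ N.bestLeaves c v u := by
  simp only [bestTest, isTrue_and, isTrue_candidateTest R hv hu ht hc, isTrue_or, isTrue_eq,
    isTrue_lt, cell, eval_add, eval_get, eval_reg, hv.offset, hu.index, ht.index, R.cost, R.weight,
    CoverInstance.bestLeaves, Finset.mem_filter, Fin.ext_iff]
  grind

/-- The computation of the contributions of the center `rV` to the gain and the price of the star
with most expensive leaf `rU`. -/
def centerProg : Program :=
  .assign rPrice (cell aCost rVOff rU - get aWeight (reg rV) +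
      (cell aCost rVOff rU - get aWeight (reg rV))) ;;
    .ite (.and (.not (get aCovered (reg rV))) (outsideTest rV rVOff rU))
      (.assign rGain (get aWeight (reg rV))) (.assign rGain 0)

theorem runs_centerProg (R : Ranked N s) (hc : Marks c (s.arr aCovered))
    (hv : AtRow s rV rVOff v) (hu : AtRow s rU rUOff u) :
    Runs M centerProg s fun s' =>
      s'.reg rPrice = N.starPrice v u ∅ ∧ s'.reg rGain = N.starGain c v u ∅ := by
  refine .seq (.mono (.assign (Q := fun s' => s'.reg rPrice = N.starPrice v u ∅) ?_)
    fun s₁ hf₁ hprice => .ite (p := v ∉ c ∧ N.Outside v u) ?_ (fun hp => .assign ?_)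
      fun hp => .assign ?_)
  · simp [cell, CoverInstance.starPrice, hv.offset, hv.index, hu.index, R.cost, R.weight, two_mul]
  · simp [isTrue_outsideTest (R.of_frame hf₁) (hv.of_frame hf₁) (hu.of_frame hf₁).index,
      (hv.of_frame hf₁).index, hf₁.arr aCovered rfl, not_iff_not.2 (hc v)]
  · simp [hprice, CoverInstance.starGain, hp, (hv.of_frame hf₁).index, (R.of_frame hf₁).weight]
  · simp [hprice, CoverInstance.starGain, hp]

/-- The computation of the gain and the price of the star with center `rV`, most expensive leaf `rU`
and the best leaves. -/
def priceProg : Program :=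
  centerProg ;; forNodes (.when bestTest
    (.assign rPrice (reg rPrice + (cell aCost rVOff rT - get aWeight (reg rT) +
        (cell aCost rVOff rT - get aWeight (reg rT)))) ;;
      .assign rGain (reg rGain + get aWeight (reg rT))))

theorem runs_priceProg (R : Ranked N s) (hM : n ≤ M) (hc : Marks c (s.arr aCovered))
    (hv : AtRow s rV rVOff v) (hu : AtRow s rU rUOff u) :
    Runs M priceProg s fun s' => s'.reg rPrice = N.starPrice v u (N.bestLeaves c v u) ∧
      s'.reg rGain = N.starGain c v u (N.bestLeaves c v u) := by
  refine .seq (.mono (runs_centerProg R hc hv hu) fun s₁ hf₁ h₁ => ?_)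
  have R₁ := R.of_frame hf₁
  have hc₁ : Marks c (s₁.arr aCovered) := hf₁.arr aCovered rfl ▸ hc
  refine (Runs.forLoop R₁.size (by decide) hM
    (fun A s' => s'.reg rPrice = N.starPrice v u (A ∩ N.bestLeaves c v u) ∧
      s'.reg rGain = N.starGain c v u (A ∩ N.bestLeaves c v u)) (by simp)
    (by simpa using h₁) fun t A s₂ ht hf₂ hrow ⟨hprice, hgain⟩ => ?_).mono
    fun s' _ h => by simpa using h.1
  have R₂ := R₁.of_frame hf₂
  have hv₂ := (hv.of_frame hf₁).of_frame hf₂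
  have hu₂ := (hu.of_frame hf₁).of_frame hf₂
  refine .when (isTrue_bestTest R₂ hv₂ hu₂ hrow (hf₂.arr aCovered rfl ▸ hc₁ t)) (fun hp =>
    .seq (.assign (.assign ?_))) fun hp => by rwa [Finset.insert_inter_of_notMem hp]
  have htA : t ∉ A ∩ N.bestLeaves c v u := fun h => ht (Finset.mem_inter.1 h).1
  rw [Finset.insert_inter_of_mem hp]
  simp only [State.setReg_reg, State.setReg_arr, cell, eval_add, eval_sub, eval_get, eval_reg,
    hrow.index, hv₂.offset, R₂.cost, R₂.weight, hprice, hgain, CoverInstance.starPrice,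
    CoverInstance.starGain, Finset.sum_insert htA, Nat.reduceEqDiff, reduceIte]
  omega

/-- The selection of this star. -/
def selectProg : Program :=
  forNodes (.when bestTest
      (.store aCovered (reg rT) 1 ;; .store aArc (reg rVOff + reg rT) 1)) ;;
    .when (outsideTest rV rVOff rU) (.store aCovered (reg rV) 1)

theorem runs_selectProg (R : Ranked N s) (hM : n ≤ M) (hc : Marks c (s.arr aCovered))
    (hD : Selects D (s.arr aArc)) (hv : AtRow s rV rVOff v) (hu : AtRow s rU rUOff u) :
    Runs M selectProg s fun s' => Marks (N.coverStar c v u) (s'.arr aCovered) ∧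
      Selects (D ∪ {v} ×ˢ N.bestLeaves c v u) (s'.arr aArc) := by
  refine .seq ((Runs.forLoop R.size (by decide) hM
    (fun A s' => Marks (c ∪ A ∩ N.bestLeaves c v u) (s'.arr aCovered) ∧
      Selects (D ∪ ({v} : Finset _) ×ˢ (A ∩ N.bestLeaves c v u)) (s'.arr aArc)) (fun _ _ _ _ h => h)
    (by simpa using ⟨hc, hD⟩) fun t A s₁ ht hf₁ hrow ⟨hc₁, hD₁⟩ => ?_).mono
    fun s₁ hf₁ ⟨⟨hc₁, hD₁⟩, _⟩ => ?_)
  · have hv₁ := hv.of_frame hf₁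
    refine .when (isTrue_bestTest (c := c) (R.of_frame hf₁) hv₁ (hu.of_frame hf₁) hrow
      (by simp [hc₁ t, ht])) (fun hp => .seq (.store (.store ?_))) fun hp => ?_
    · rw [Finset.insert_inter_of_mem hp, Finset.union_insert, Finset.singleton_product,
        Finset.map_insert, Finset.union_insert, ← Finset.singleton_product]
      exact ⟨by simpa [hrow.index] using hc₁.insert t,
        by simpa [hrow.index, hv₁.offset] using hD₁.insert v t⟩
    · rw [Finset.insert_inter_of_notMem hp]
      exact ⟨hc₁, hD₁⟩
  · rw [Finset.univ_inter] at hc₁ hD₁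
    have hv₁ := hv.of_frame hf₁
    refine .when (isTrue_outsideTest (R.of_frame hf₁) hv₁ (hu.of_frame hf₁).index)
      (fun hp => .store ?_) fun hp => ?_
    · rw [CoverInstance.coverStar, Finset.filter_singleton, if_pos hp, Finset.union_singleton]
      exact ⟨by simpa [hv₁.index] using hc₁.insert v, hD₁⟩
    · rw [CoverInstance.coverStar, Finset.filter_singleton, if_neg hp, Finset.union_empty]
      exact ⟨hc₁, hD₁⟩

/-- The selection of stars that gain more than their price, as long as there are any. -/
def starProg : Program :=
  forPairs (priceProg ;;
    .when (.and (candidateTest rU rUOff) (.lt (reg rPrice) (reg rGain))) selectProg)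

theorem runs_starProg (R : Ranked N s) (hM : n ≤ M) (hcovered : ∀ v : Fin n, s.arr aCovered v = 0)
    (harc : ∀ v u : Fin n, s.arr aArc (v * n + u) = 0) :
    Runs M starProg s fun s' => ∃ c D, N.Progress c D .univ ∧ Marks c (s'.arr aCovered) ∧
      Selects D (s'.arr aArc) := by
  refine Runs.forPairs R.size (by decide) hM (fun seen f => ∃ c D, N.Progress c D seen ∧
    Marks c (f aCovered) ∧ Selects D (f aArc)) ⟨∅, ∅, .init N, by simp [Marks, hcovered],
      by simp [Selects, harc]⟩ ?_
  rintro v u seen s₁ - hf₁ hv hu ⟨c, D, hprog, hc, hD⟩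
  have R₁ := R.of_frame hf₁
  refine .seq ((runs_priceProg R₁ hM hc hv hu).mono fun s₂ hf₂ ⟨hprice, hgain⟩ => ?_)
  have R₂ := R₁.of_frame hf₂
  have hv₂ := hv.of_frame hf₂
  have hu₂ := hu.of_frame hf₂
  have hc₂ : Marks c (s₂.arr aCovered) := hf₂.arr aCovered rfl ▸ hc
  have hD₂ : Selects D (s₂.arr aArc) := hf₂.arr aArc rfl ▸ hD
  refine .when (p := u ∈ N.candidates c v u ∧ N.starPrice v u (N.bestLeaves c v u) <
      N.starGain c v u (N.bestLeaves c v u))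
    (by simp [isTrue_candidateTest R₂ hv₂ hu₂ hu₂ (hc₂ u), hprice, hgain]) (fun hp => ?_)
    fun hp => ⟨c, D, hprog.insert_seen ?_, hc₂, hD₂⟩
  · exact (runs_selectProg R₂ hM hc₂ hD₂ hv₂ hu₂).mono fun s₃ _ ⟨hc₃, hD₃⟩ =>
      ⟨_, _, hprog.select_seen hp.1 hp.2, hc₃, hD₃⟩
  · by_cases hu : u ∈ N.candidates c v u
    · exact CoverInstance.exhausted_of_starGain_bestLeaves_le
        (not_lt.1 fun hlt => hp ⟨hu, hlt⟩)
    · exact CoverInstance.exhausted_of_notMem_candidates hu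

end Star

section Completion

variable {M n : ℕ} {N : CoverInstance (Fin n)} {s : State} {c : Finset (Fin n)}
  {D : Finset (Fin n × Fin n)}

/-- The selection of the first edges at all vertices. -/
def completionProg : Program :=
  forPairs (.when (.and (cell aAdj rVOff rU)
      (.or (.lt (cell aRank rVOff rU + 1) (get aReq (reg rV)))
        (.and (.not (get aCovered (reg rV))) (.lt (cell aRank rVOff rU) (get aReq (reg rV))))))
    (.store aArc (reg rVOff + reg rU) 1))

theorem runs_completionProg (R : Ranked N s) (hM : n ≤ M) (hc : Marks c (s.arr aCovered))
    (hD : Selects D (s.arr aArc)) :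
    Runs M completionProg s fun s' => Selects (D ∪ N.completion c) (s'.arr aArc) := by
  refine (Runs.forPairs R.size (by decide) hM
    (fun seen f => Selects (D ∪ N.completion c ∩ seen) (f aArc)) (by simpa using hD)
    fun v u seen s₁ _ hf₁ hv hu hseen => ?_).mono fun s' _ h => by simpa using h
  have R₁ := R.of_frame hf₁
  have hc₁ : Marks c (s₁.arr aCovered) := hf₁.arr aCovered rfl ▸ hc
  refine .when (p := (v, u) ∈ N.completion c) ?_ (fun hp => .store ?_) fun hp => ?_
  · have hquota : N.rank v u + 1 < N.req v ∨ v ∉ c ∧ N.rank v u < N.req v ↔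
        N.rank v u < N.quota c v := by
      by_cases hvc : v ∈ c <;> simp only [CoverInstance.quota, hvc, if_true, if_false] <;> grind
    simp [cell, hv.index, hv.offset, hu.index, R₁.adj, R₁.rank, R₁.req, not_iff_not.2 (hc₁ v),
      CoverInstance.mem_completion, hquota]
  · rw [Finset.inter_insert_of_mem hp, Finset.union_insert]
    simpa [hv.offset, hu.index] using hseen.insert v u
  · rwa [Finset.inter_insert_of_notMem hp]

/-- The solution of an instance with natural-number costs. -/
def solveProg : Program := rankProg ;; weightProg ;; starProg ;; completionProg

theorem runs_solveProg (H : Holds N s) (hM : n ≤ M)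
    (harc : ∀ v u : Fin n, s.arr aArc (v * n + u) = 0)
    (hweight : ∀ v : Fin n, s.arr aWeight v = 0) (hcovered : ∀ v : Fin n, s.arr aCovered v = 0) :
    Runs M solveProg s fun s' =>
      ∃ c D, N.Progress c D .univ ∧ Selects (D ∪ N.completion c) (s'.arr aArc) := by
  refine .seq ((runs_rankProg H hM).mono fun s₁ hf₁ hrank => ?_)
  refine .seq ((runs_weightProg (H.of_frame hf₁) hM (by simpa [hf₁.arr aWeight rfl]) hrank).mono
    fun s₂ hf₂ R => ?_)
  refine .seq ((runs_starProg R hM (by simpa [hf₂.arr aCovered rfl, hf₁.arr aCovered rfl])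
    (by simpa [hf₂.arr aArc rfl, hf₁.arr aArc rfl])).mono fun s₃ hf₃ ⟨c, D, hprog, hc, hD⟩ => ?_)
  exact (runs_completionProg (R.of_frame hf₃) hM hc hD).mono fun s₄ _ h => ⟨c, D, hprog, h⟩

end Completion

end RAM

namespace MPEMC

open Finset

/-- A common denominator of the costs: the product of the denominators of the edges. -/
noncomputable def scaleFactor (I : MPEMC) : ℕ :=
  ∏ q : Fin (I.n * I.n), if rowMajor I.den q ≠ 0 then rowMajor I.den q else 1

open scoped Classical in
/-- The instance with the costs multiplied by `scaleFactor`, which makes them natural numbers. -/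
noncomputable def coverInstance (I : MPEMC) : CoverInstance (Fin I.n) where
  graph := I.graph
  cost e := if e ∈ I.graph.edgeSet then ⌊I.scaleFactor * I.cost e⌋₊ else 0
  req := I.req

variable {I : MPEMC} {v u : Fin I.n} {J K : Finset (Sym2 (Fin I.n))}

section Scaling

theorem cell_lt {n : ℕ} (v u : Fin n) : (v * n + u : ℕ) < n * n := by
  simpa [add_comm, mul_comm] using (finProdFinEquiv (v, u)).isLt

theorem rowMajor_cell {n : ℕ} (A : Fin n → Fin n → ℕ) (v u : Fin n) :
    rowMajor A (v * n + u) = A v u := by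
  have hcell : (⟨v * n + u, cell_lt v u⟩ : Fin (n * n)) = finProdFinEquiv (v, u) := by
    simp [Fin.ext_iff, add_comm, mul_comm]
  simp only [rowMajor, cell_lt, dite_true, hcell, Equiv.symm_apply_apply]

theorem den_ne_zero_iff : I.den v u ≠ 0 ↔ I.graph.Adj v u := by
  simp [den]

theorem scaleFactor_pos : 0 < I.scaleFactor :=
  prod_pos fun q _ => by split_ifs <;> omega

theorem scaleFactor_mul_cost (h : I.graph.Adj v u) :
    (I.scaleFactor * I.cost s(v, u) : ℚ≥0) = (I.num v u *
      ∏ q : Fin (I.n * I.n), RAM.scaleFactorAt (rowMajor I.den) (v * I.n + u) q : ℕ) := by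
  have hnum : (I.num v u : ℚ≥0) = I.cost s(v, u) * I.den v u := by
    simp only [num, den, h, if_true]
    exact (NNRat.mul_den_eq_num _).symm
  have hprod := RAM.prod_scaleFactorAt_mul (d := rowMajor I.den) (m := ⟨_, cell_lt v u⟩)
    (by rw [rowMajor_cell]; exact den_ne_zero_iff.2 h)
  rw [rowMajor_cell] at hprod
  rw [scaleFactor, ← hprod]
  push_cast
  rw [hnum]
  ring

theorem coverInstance_cost (v u : Fin I.n) : I.coverInstance.cost s(v, u) = I.num v u *
    ∏ q : Fin (I.n * I.n), RAM.scaleFactorAt (rowMajor I.den) (v * I.n + u) q := by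
  by_cases h : I.graph.Adj v u
  · exact (if_pos h).trans (by rw [scaleFactor_mul_cost h, Nat.floor_natCast])
  · simp [coverInstance, num, h]

theorem cast_coverInstance_cost (h : I.graph.Adj v u) :
    (I.coverInstance.cost s(v, u) : ℚ≥0) = I.scaleFactor * I.cost s(v, u) := by
  rw [scaleFactor_mul_cost h, coverInstance_cost]

end Scaling

section Program

theorem n_mul_n_le_size : I.n * I.n ≤ I.size := by
  have h : ∑ v : Fin I.n, ∑ u : Fin I.n, 1 ≤
      ∑ v, ∑ u, (((I.num v u).size + 1) + ((I.den v u).size + 1)) :=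
    sum_le_sum fun v _ => sum_le_sum fun u _ => by omega
  simp only [sum_const, card_univ, Fintype.card_fin, smul_eq_mul, mul_one] at h
  unfold size
  omega

theorem size_den_le_size (v u : Fin I.n) : (I.den v u).size ≤ I.size := by
  have entry := single_le_sum (f := fun u => ((I.num v u).size + 1) + ((I.den v u).size + 1))
    (fun _ _ => Nat.zero_le _) (mem_univ u)
  have row := single_le_sum
    (f := fun v => ∑ u, (((I.num v u).size + 1) + ((I.den v u).size + 1)))
    (fun _ _ => Nat.zero_le _) (mem_univ v)
  unfold size
  omega

theorem size_rowMajor_den_le_size (q : ℕ) : (rowMajor I.den q).size ≤ I.size := by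
  unfold rowMajor
  split_ifs
  · exact size_den_le_size _ _
  · simp

/-- The approximation algorithm: scale the costs to natural numbers, select stars greedily, and
complete the selection by cheapest edges. -/
def program : RAM.Program := .seq RAM.prepareProg RAM.solveProg

theorem runs_prepareProg : RAM.Runs I.size RAM.prepareProg I.input (RAM.Holds I.coverInstance) := by
  refine (RAM.runs_prepareProg rfl n_mul_n_le_size fun q _ => size_rowMajor_den_le_size q).mono
    fun s hf hcost => ⟨hf.reg 0 rfl, fun v => ?_, fun v u => ?_, fun v u => ?_⟩
  · rw [hf.arr 0 rfl]
    simp [input, coverInstance]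
  · rw [hcost _ (cell_lt v u), coverInstance_cost, ← rowMajor_cell I.num]
    rfl
  · have hden : I.input.arr 2 (v * I.n + u) = I.den v u := rowMajor_cell I.den v u
    rw [hf.arr 2 rfl, hden]
    exact den_ne_zero_iff

theorem runs_program : RAM.Runs I.size program I.input fun s =>
    ∃ c D, I.coverInstance.Progress c D univ ∧
      RAM.Selects (D ∪ I.coverInstance.completion c) (s.arr 3) :=
  .seq (runs_prepareProg.mono fun s hf H => RAM.runs_solveProg H
    ((Nat.le_mul_self _).trans n_mul_n_le_size) (fun _ _ => by rw [hf.arr 3 rfl]; rfl)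
    (fun _ => by rw [hf.arr 5 rfl]; rfl) fun _ => by rw [hf.arr 6 rfl]; rfl)

end Program

section Transfer

theorem card_incident {H : SimpleGraph (Fin I.n)} (hJ : (J : Set (Sym2 (Fin I.n))) = H.edgeSet)
    (v : Fin I.n) : #(incident J v) = (H.neighborSet v).ncard := by
  have : (incident J v : Set (Sym2 (Fin I.n))) = H.incidenceSet v := by
    ext e
    simp [incident, SimpleGraph.incidenceSet, ← hJ]
  rw [← Set.ncard_coe_finset, this]
  exact Nat.card_congr (H.incidenceSetEquivNeighborSet v)

theorem isCover_iff {H : SimpleGraph (Fin I.n)} (hJ : (J : Set (Sym2 (Fin I.n))) = H.edgeSet) :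
    I.IsCover J ↔ I.coverInstance.IsCover H := by
  have hle : (∀ e ∈ J, e ∈ I.graph.edgeSet) ↔ H ≤ I.graph := by
    rw [← SimpleGraph.edgeSet_subset_edgeSet, ← hJ]
    rfl
  simp only [IsCover, card_incident hJ, hle]
  exact ⟨fun h => ⟨h.1, h.2⟩, fun h => ⟨h.le, h.req_le⟩⟩

theorem IsCover.coe_eq_edgeSet (hJ : I.IsCover J) :
    (J : Set (Sym2 (Fin I.n))) = (SimpleGraph.fromEdgeSet (J : Set (Sym2 (Fin I.n)))).edgeSet := by
  rw [SimpleGraph.edgeSet_fromEdgeSet, eq_comm, sdiff_eq_left, Set.disjoint_left]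
  exact fun e he => I.graph.not_isDiag_of_mem_edgeSet (hJ.1 e he)

theorem scaleFactor_mul_nodePower_le {p : ℕ} (hJ : ∀ e ∈ J, e ∈ I.graph.edgeSet)
    (hp : ∀ u, s(v, u) ∈ J → I.coverInstance.cost s(v, u) ≤ p) :
    I.scaleFactor * I.nodePower J v ≤ p := by
  have hD : (0 : ℚ≥0) < I.scaleFactor := by exact_mod_cast scaleFactor_pos
  rw [← le_div_iff₀' hD]
  refine Finset.sup_le fun e he => ?_
  obtain ⟨he, u, rfl⟩ := mem_filter.1 he
  rw [le_div_iff₀' hD, ← cast_coverInstance_cost (hJ _ he)]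
  exact_mod_cast hp u he

theorem cost_le_floor_nodePower (hK : ∀ e ∈ K, e ∈ I.graph.edgeSet) (h : s(v, u) ∈ K) :
    I.coverInstance.cost s(v, u) ≤ ⌊I.scaleFactor * I.nodePower K v⌋₊ := by
  refine Nat.le_floor ?_
  rw [cast_coverInstance_cost (hK _ h)]
  gcongr
  exact le_sup (f := I.cost) (mem_filter.2 ⟨h, Sym2.mem_mk_left v u⟩)

theorem power_le_of_scaled {p : Fin I.n → ℕ} {k : ℕ}
    (hp : ∀ v, I.scaleFactor * I.nodePower J v ≤ p v)
    (hsum : 2 * ∑ v, p v ≤ (2 * k + 1) * ∑ v, ⌊I.scaleFactor * I.nodePower K v⌋₊) :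
    I.power J ≤ ((k : ℚ≥0) + 1 / 2) * I.power K := by
  have hD : (0 : ℚ≥0) < I.scaleFactor := by exact_mod_cast scaleFactor_pos
  have hK : ∑ v, (⌊I.scaleFactor * I.nodePower K v⌋₊ : ℚ≥0) ≤ I.scaleFactor * I.power K := by
    rw [power, mul_sum]
    exact sum_le_sum fun v _ => Nat.floor_le zero_le
  refine le_of_mul_le_mul_left ?_ (mul_pos two_pos hD)
  calc 2 * (I.scaleFactor : ℚ≥0) * I.power J
      = 2 * ∑ v, I.scaleFactor * I.nodePower J v := by rw [mul_assoc, power, mul_sum]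
    _ ≤ 2 * ∑ v, (p v : ℚ≥0) := by gcongr with v; exact hp v
    _ ≤ (2 * k + 1) * ∑ v, (⌊I.scaleFactor * I.nodePower K v⌋₊ : ℚ≥0) := by exact_mod_cast hsum
    _ ≤ (2 * k + 1) * (I.scaleFactor * I.power K) := by gcongr
    _ = 2 * I.scaleFactor * ((k + 1 / 2) * I.power K) := by
      rw [show (2 * k + 1 : ℚ≥0) = 2 * (k + 1 / 2) by rw [mul_add]; norm_num]
      ring

end Transfer

section Output

variable {s : RAM.State} {c : Finset (Fin I.n)} {D : Finset (Fin I.n × Fin I.n)}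

theorem coe_output (hs : RAM.Selects D (s.arr 3)) (hD : ∀ v u, (v, u) ∈ D → v ≠ u) :
    (I.output s : Set (Sym2 (Fin I.n))) =
      (SimpleGraph.fromRel fun v u => (v, u) ∈ D).edgeSet := by
  ext e
  induction e with | _ v u
  simp only [output, hs _ _, coe_image, Set.mem_image, mem_coe, mem_filter, mem_univ, true_and,
    Prod.exists, SimpleGraph.mem_edgeSet, SimpleGraph.fromRel_adj, Sym2.eq_iff]
  constructor
  · rintro ⟨a, b, hab, ⟨rfl, rfl⟩ | ⟨rfl, rfl⟩⟩
    exacts [⟨hD _ _ hab, .inl hab⟩, ⟨(hD _ _ hab).symm, .inr hab⟩]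
  · rintro ⟨-, h | h⟩
    exacts [⟨v, u, h, .inl ⟨rfl, rfl⟩⟩, ⟨u, v, h, .inr ⟨rfl, rfl⟩⟩]

theorem isCover_output (hprog : I.coverInstance.Progress c D univ)
    (hs : RAM.Selects (D ∪ I.coverInstance.completion c) (s.arr 3)) (hK : I.IsCover K) :
    I.IsCover (I.output s) :=
  (isCover_iff (coe_output hs fun _ _ h => (hprog.adj_of_mem_union h).ne)).2
    (hprog.isCover ((isCover_iff hK.coe_eq_edgeSet).1 hK))

theorem power_output_le (hprog : I.coverInstance.Progress c D univ)
    (hs : RAM.Selects (D ∪ I.coverInstance.completion c) (s.arr 3)) (hK : I.IsCover K) :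
    I.power (I.output s) ≤ ((I.maxReq : ℚ≥0) + 1 / 2) * I.power K := by
  have hcover := isCover_output hprog hs hK
  obtain ⟨p, hp, hsum⟩ := ((isCover_iff hK.coe_eq_edgeSet).1 hK).exists_affords_le
    (P := fun v => ⌊I.scaleFactor * I.nodePower K v⌋₊)
    (fun v u h => cost_le_floor_nodePower hK.1 ((SimpleGraph.fromEdgeSet_adj _).1 h).1)
    (fun v => le_sup (f := I.req) (mem_univ v)) hprog
  refine power_le_of_scaled (fun v => scaleFactor_mul_nodePower_le hcover.1 fun u hu => ?_) hsum
  have hadj : s(v, u) ∈ (I.output s : Set (Sym2 (Fin I.n))) := hu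
  rw [coe_output hs fun _ _ h => (hprog.adj_of_mem_union h).ne] at hadj
  rcases hadj.2 with h | h
  · exact (hp v u h).1
  · exact Sym2.eq_swap (a := u) ▸ (hp u v h).2

end Output

end MPEMC

theorem theorem2 :
    ∃ (P : RAM.Program) (p : Polynomial ℕ), ∀ I : MPEMC,
      ∃ (s : RAM.State) (t : ℕ), RAM.Exec P I.input s t ∧ t ≤ p.eval I.size ∧
        ((∃ J, I.IsCover J) →
          I.IsCover (I.output s) ∧
            ∀ J, I.IsCover J →
              I.power (I.output s) ≤ ((I.maxReq : ℚ≥0) + 1 / 2) * I.power J) := by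
  refine ⟨MPEMC.program, MPEMC.program.timeBound, fun I => ?_⟩
  obtain ⟨s, t, hexec, ht, c, D, hprog, hs⟩ := MPEMC.runs_program (I := I)
  exact ⟨s, t, hexec, ht, fun ⟨K, hK⟩ =>
    ⟨MPEMC.isCover_output hprog hs hK, fun K' hK' => MPEMC.power_output_le hprog hs hK'⟩⟩
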